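/- Let $k\ge 1$ and $n=2k+3$. An edge is a two-element subset of $[n]=\{1,\dots,n\}$; two edges $\{i,j\}$, $\{i',j'\}$ with $i<j$, $i'<j'$ cross if $i<i'<j<j'$ or $i'<i<j'<j$. A set of edges is $(k+1)$-crossing-free if it does not contain $k+1$ pairwise crossing edges, and a $k$-triangulation is a maximal $(k+1)$-crossing-free set. The length of $\{i,j\}$ is $\min(|j-i|,n-|j-i|)$, and an edge is relevant if its length is at least $k+1$. The reduced $k$-associahedron $\overline{\Delta}_{k,n}$ is the simplicial complex whose faces are the $(k+1)$-crossing-free sets of relevant edges. A $k$-triangulation is octahedral if it misses exactly three edges and these have six distinct endpoints. Let $\mathbf q=(q_1,\dots,q_n)$, $q_i=(x_i,y_i)\in\mathbb R^2$, be in convex position, that is, $q_1,\dots,q_n$ are the vertices of a convex polygon, labelled in cyclic order along its boundary. The cofactor matrix $C_{d}(\mathbf q)$, $d=2k$, has a row for each edge $\{i,j\}$, $i<j$, and a block of $d$ columns for each vertex; the row of $\{i,j\}$ has $\mathbf c_{ij}=\bigl((x_i-x_j)^{d-1},(y_i-y_j)(x_i-x_j)^{d-2},\dots,(y_i-y_j)^{d-1}\bigr)$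 in block $i$, $-\mathbf c_{ij}$ in block $j$, and zeros elsewhere. We say that $C_{2k}(\mathbf q)$ realizes $\overline{\Delta}_{k,n}$ as a complete fan if the rows of the edges of length at most $k$ are linearly independent and, for the images $v_e$ of the rows in the quotient of the row space by the span of those rows: the vectors $v_e$, $e\in F$, are linearly independent for every face $F$ of $\overline{\Delta}_{k,n}$; $\operatorname{cone}(v_F)\cap\operatorname{cone}(v_G)=\operatorname{cone}(v_{F\cap G})$ for all faces $F,G$, where $\operatorname{cone}(v_F)$ is the set of nonnegative linear combinations of the $v_e$, $e\in F$; and these cones cover the whole quotient space. For a relevant edge $\{i,j\}$, the line through $q_i$ and $q_j$ leaves $k$ points of $\mathbf q$ strictly on one side and $k+1$ strictly on the other. The big half-plane of $\{i,j\}$ is the open half-plane, bounded by that line, that contains $k+1$ points. Then the following are equivalent: 1. $C_{2k}(\mathbf q)$ realizes $\overline{\Delta}_{k,2k+3}$ as a complete fan. 2. For every octahedral $k$-triangulation $T$, the big half-planes of the three edges not in $T$ have non-empty intersection. 3. The big half-planes of all relevant edges have non-empty intersection. -/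

import Mathlib

namespace Multiassociahedron

/-! ### Combinatorics of multitriangulations -/

/-- The two-element subsets `{i, j}`, `i < j`, of the vertex set of a cyclically labelled `n`-gon.
The vertices are labelled by `Fin n`. -/
abbrev Edge (n : ℕ) : Type := {e : Fin n × Fin n // e.1 < e.2}

/-- The smaller endpoint of an edge. -/
abbrev Edge.fst {n : ℕ} (e : Edge n) : Fin n := e.1.1

/-- The larger endpoint of an edge. -/
abbrev Edge.snd {n : ℕ} (e : Edge n) : Fin n := e.1.2

/-- The set of the two endpoints of an edge. -/
def Edge.endpoints {n : ℕ} (e : Edge n) : Finset (Fin n) := {e.fst, e.snd}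

/-- Two edges cross (as diagonals of a convex `n`-gon). -/
def Cross {n : ℕ} (e f : Edge n) : Prop :=
  (e.fst < f.fst ∧ f.fst < e.snd ∧ e.snd < f.snd) ∨
    (f.fst < e.fst ∧ e.fst < f.snd ∧ f.snd < e.snd)

/-- An `m`-crossing: a set of `m` pairwise crossing edges. -/
def IsCrossing {n : ℕ} (m : ℕ) (C : Finset (Edge n)) : Prop :=
  C.card = m ∧ ∀ e ∈ C, ∀ f ∈ C, e ≠ f → Cross e f

/-- A set of edges is `m`-crossing-free if it contains no `m`-crossing. -/
def CrossingFree {n : ℕ} (m : ℕ) (S : Finset (Edge n)) : Prop :=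
  ∀ C ⊆ S, ¬ IsCrossing m C

/-- A `k`-triangulation of the `n`-gon: a maximal `(k+1)`-crossing-free set of edges. -/
def IsTriangulation {n : ℕ} (k : ℕ) (T : Finset (Edge n)) : Prop :=
  Maximal (CrossingFree (k + 1)) T

/-- The cyclic length `min (|j - i|) (n - |j - i|)` of an edge `{i, j}`. -/
def Edge.length {n : ℕ} (e : Edge n) : ℕ :=
  min ((e.snd : ℕ) - (e.fst : ℕ)) (n - ((e.snd : ℕ) - (e.fst : ℕ)))

/-- An edge is relevant if its length is at least `k + 1`. -/
def Relevant {n : ℕ} (k : ℕ) (e : Edge n) : Prop := k + 1 ≤ e.length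

/-- The faces (including the empty one) of the reduced `k`-associahedron of the `n`-gon:
the `(k+1)`-crossing-free sets of relevant edges. -/
def reducedAssociahedron (k n : ℕ) : Set (Finset (Edge n)) :=
  {F | CrossingFree (k + 1) F ∧ ∀ e ∈ F, Relevant k e}

/-- A `k`-triangulation of the `(2k+3)`-gon is octahedral if its three missing edges have six
distinct endpoints. -/
def IsOctahedral (k : ℕ) (T : Finset (Edge (2 * k + 3))) : Prop :=
  IsTriangulation k T ∧ (Tᶜ).card = 3 ∧
    ∀ e ∈ Tᶜ, ∀ f ∈ Tᶜ, e ≠ f → Disjoint e.endpoints f.endpoints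

/-! ### Complete simplicial fans -/

/-- The cone of nonnegative combinations of the vectors `v i`, `i ∈ F`. -/
def coneOf {ι W : Type*} [AddCommGroup W] [Module ℝ W] (v : ι → W) (F : Finset ι) : Set W :=
  {w | ∃ c : ι → ℝ, (∀ i ∈ F, 0 ≤ c i) ∧ w = ∑ i ∈ F, c i • v i}

/-- The vector configuration `v` realizes the simplicial complex with set of faces `Δ` as a
complete simplicial fan in the linear span of `v`: every face indexes linearly independent vectors,
the cones of any two faces meet exactly in the cone of their common face, and the cones cover the
linear span of the configuration. -/
structure RealizesCompleteFan {ι W : Type*} [DecidableEq ι] [AddCommGroup W] [Module ℝ W]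
    (v : ι → W) (Δ : Set (Finset ι)) : Prop where
  linearIndepOn : ∀ F ∈ Δ, LinearIndepOn ℝ v (F : Set ι)
  inter_eq : ∀ F ∈ Δ, ∀ G ∈ Δ, coneOf v F ∩ coneOf v G = coneOf v (F ∩ G)
  complete : ⋃ F ∈ Δ, coneOf v F = (Submodule.span ℝ (Set.range v) : Set W)

/-- The contraction of the vector configuration `v` at `I`: the images of the vectors in the
quotient by the linear span of the vectors indexed by `I`. The elements of `I` become zero. -/
def contraction {ι W : Type*} [AddCommGroup W] [Module ℝ W] (v : ι → W) (I : Set ι) :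
    ι → W ⧸ Submodule.span ℝ (v '' I) :=
  fun i => (Submodule.span ℝ (v '' I)).mkQ (v i)

/-- The vectors `v e`, indexed by all edges, realize the reduced `k`-associahedron as a complete
fan: the vectors of the non-relevant edges (those of length at most `k`) are linearly independent
and the contraction at them realizes the complex as a complete fan. -/
def RealizesAssociahedron {n : ℕ} {W : Type*} [AddCommGroup W] [Module ℝ W]
    (k : ℕ) (v : Edge n → W) : Prop :=
  LinearIndepOn ℝ v {e | ¬ Relevant k e} ∧
    RealizesCompleteFan (contraction v {e | ¬ Relevant k e}) (reducedAssociahedron k n)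

/-! ### Points in the plane and cofactor rigidity -/

/-- The determinant of the rows `(a, 1)`, `(b, 1)`, `(c, 1)`: positive when `a, b, c` are in
counterclockwise order, negative when they are in clockwise order, zero when they are collinear. -/
def orient (a b c : ℝ × ℝ) : ℝ :=
  (b.1 - a.1) * (c.2 - a.2) - (b.2 - a.2) * (c.1 - a.1)

/-- The points `q 0, …, q (n-1)` are in convex position: they are the vertices of a convex polygon,
labelled in their cyclic order along its boundary (counterclockwise or clockwise). -/
def ConvexPosition {n : ℕ} (q : Fin n → ℝ × ℝ) : Prop :=
  (∀ a b c : Fin n, a < b → b < c → 0 < orient (q a) (q b) (q c)) ∨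
    (∀ a b c : Fin n, a < b → b < c → orient (q a) (q b) (q c) < 0)

/-- The vector `((x_i-x_j)^(d-1), (y_i-y_j)(x_i-x_j)^(d-2), …, (y_i-y_j)^(d-1))`. -/
def cofactorVector {n : ℕ} (d : ℕ) (q : Fin n → ℝ × ℝ) (i j : Fin n) : Fin d → ℝ :=
  fun t => ((q i).2 - (q j).2) ^ (t : ℕ) * ((q i).1 - (q j).1) ^ (d - 1 - (t : ℕ))

/-- The cofactor rigidity matrix `C_d(q)`. Its rows are indexed by the edges `{i, j}` with `i < j`,
its columns by `n` blocks of size `d`; the row of `{i, j}` has the cofactor vector in block `i`, its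
negative in block `j`, and zeros elsewhere. -/
def cofactorMatrix {n : ℕ} (d : ℕ) (q : Fin n → ℝ × ℝ) : Matrix (Edge n) (Fin n × Fin d) ℝ :=
  Matrix.of fun e s =>
    if s.1 = e.fst then cofactorVector d q e.fst e.snd s.2
    else if s.1 = e.snd then - cofactorVector d q e.fst e.snd s.2
    else 0

/-- The big half-plane of an edge `{i, j}`: the open side of the line through `q i` and `q j` that
contains exactly `k + 1` points of the configuration. Two points lie strictly on the same side of
that line if and only if the product of their orientations is positive. -/
def bigHalfPlane (k : ℕ) (q : Fin (2 * k + 3) → ℝ × ℝ) (e : Edge (2 * k + 3)) : Set (ℝ × ℝ) :=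
  {p | {v : Fin (2 * k + 3) |
      0 < orient (q e.fst) (q e.snd) p * orient (q e.fst) (q e.snd) (q v)}.ncard = k + 1}

end Multiassociahedron

namespace Multiassociahedron

/-! ### Complete fans via Gale duality -/

section Gale

variable {ι W V : Type*} [AddCommGroup W] [Module ℝ W] [NormedAddCommGroup V] [NormedSpace ℝ V]

/-! The argument is Gale duality in dimension three. There are `2k + 3 = d + 3` points, and for even
`d` the linear dependencies among the rows of the cofactor matrix form a space parametrized by `p`
in `ℝ³`: the coefficient of the edge `{i, j}` is `det(q_i, q_j, p)` divided by the product of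
`orient (q i) (q j) (q l)` over the other vertices `l` (`sum_row_eq_zero_iff_exists`). For a
relevant edge, a sign count shows that, up to a positive factor and the global sign `(-1)^k`, this
is the linear form that is positive on the big half-plane (`exists_edgeForm_eq`). Contracting the
short edges only means forgetting their coefficients.

Index the relevant edges cyclically by `i ↦ {i, i + k + 1}`. The `(k+1)`-crossings are exactly the
windows of `k + 1` consecutive edges, so a set is a face iff its complement meets every window,
which amounts to missing three edges whose cyclic gaps are at most `k + 1` (`ShortSteps`). The
directions of such a triple positively span the plane, so a positive combination of their forms is a
multiple of the height coordinate of `ℝ³`; the multiple is positive once all big half-planes have a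
common point (`height_eq_combination`).

From 3 to 1: the height is a positive combination of forms outside every face, which makes cones
meet properly; minimizing it over all nonnegative representations of a vector gives a representation
supported on a face (`realizes_of_gale`). From 1 to 3: completeness yields a strictly positive
dependency, that is, a `p` on the positive side of every form, and `p` has positive height.

From 2 to 3: by Helly in the plane it suffices to treat three half-planes. Triples that miss a
window, or in which two edges share a vertex, always intersect near a vertex of the polygon; the
remaining ones are the complements of octahedral triangulations. From 3 to 2: edges missing from a
`k`-triangulation are relevant. -/

theorem contraction_eq_zero {v : ι → W} {I : Set ι} {e : ι} (he : e ∈ I) :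
    contraction v I e = 0 := by
  simp only [contraction, Submodule.mkQ_apply, Submodule.Quotient.mk_eq_zero]
  exact Submodule.subset_span ⟨e, he, rfl⟩

/-- If the linear dependencies of `v` are given by evaluating the functionals `ω e`, then those of
the contraction at `I` are given by evaluating the functionals `ω e`, `e ∉ I`. -/
theorem sum_contraction_eq_zero_iff [Fintype ι] {v : ι → W} {I : Set ι} {ω : ι → V →ₗ[ℝ] ℝ}
    (hdep : ∀ c : ι → ℝ, ∑ e, c e • v e = 0 ↔ ∃ p, ∀ e, c e = ω e p) (c : ι → ℝ) :
    ∑ e, c e • contraction v I e = 0 ↔ ∃ p, ∀ e ∉ I, c e = ω e p := by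
  classical
  have key : ∀ c : ι → ℝ, ∑ e, c e • contraction v I e
      = (Submodule.span ℝ (v '' I)).mkQ (∑ e, c e • v e) := by
    intro c; simp [contraction]
  constructor
  · intro h
    rw [key, Submodule.mkQ_apply, Submodule.Quotient.mk_eq_zero,
      Finsupp.mem_span_image_iff_linearCombination] at h
    obtain ⟨l, hl, hl2⟩ := h
    rw [Finsupp.linearCombination_apply, Finsupp.sum_fintype _ _ (by simp)] at hl2
    -- The image vanishes because the sum lies in the span of `I`; subtracting a combination `l`
    -- supported on `I` gives a dependency of `v` itself.
    obtain ⟨p, hp⟩ := (hdep (fun e => c e - l e)).1 (by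
      simp only [sub_smul, Finset.sum_sub_distrib]; rw [hl2, sub_self])
    refine ⟨p, fun e he => ?_⟩
    have h0 : l e = 0 := by
      by_contra hne
      exact he (hl (by simpa using hne))
    rw [← hp e, h0, sub_zero]
  · rintro ⟨p, hp⟩
    have : ∑ e, c e • contraction v I e = ∑ e, ω e p • contraction v I e := by
      refine Finset.sum_congr rfl fun e _ => ?_
      by_cases he : e ∈ I
      · rw [contraction_eq_zero he, smul_zero, smul_zero]
      · rw [hp e he]
    rw [this, key, (hdep _).2 ⟨p, fun _ => rfl⟩, map_zero]

theorem sum_extend [Fintype ι] [DecidableEq ι] (v : ι → W) (F : Finset ι) (c : ι → ℝ) :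
    ∑ e, (if e ∈ F then c e else 0) • v e = ∑ e ∈ F, c e • v e := by
  simp [ite_smul, Finset.sum_ite_mem]

/-- A functional bounded below on a polyhedron with pointed sublevel sets attains its minimum. -/
theorem exists_min_on_polyhedron [FiniteDimensional ℝ V] {I : Set ι} {ω : ι → V →ₗ[ℝ] ℝ} {h : V →ₗ[ℝ] ℝ}
    {x y z : ι} (hx : x ∉ I) (hy : y ∉ I) (hz : z ∉ I) {lx ly lz : ℝ}
    (hlx : 0 < lx) (hly : 0 < ly) (hlz : 0 < lz)
    (hh : ∀ p, h p = lx * ω x p + ly * ω y p + lz * ω z p)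
    (hinj : ∀ p, ω x p = 0 → ω y p = 0 → ω z p = 0 → p = 0)
    (c : ι → ℝ) {p₁ : V} (hp₁ : ∀ e ∉ I, 0 ≤ c e + ω e p₁) :
    ∃ p, (∀ e ∉ I, 0 ≤ c e + ω e p) ∧ ∀ p', (∀ e ∉ I, 0 ≤ c e + ω e p') → h p ≤ h p' := by
  have hcont : ∀ f : V →ₗ[ℝ] ℝ, Continuous f := fun f => f.continuous_of_finiteDimensional
  -- The three forms embed `V` as a closed subspace of `ℝ³`. On a sublevel set of `h` the three
  -- slacks are nonnegative with weighted sum at most `M`, so the image lies in a box.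
  let Φ : V →ₗ[ℝ] ℝ × ℝ × ℝ := (ω x).prod ((ω y).prod (ω z))
  have hΦp : ∀ p, Φ p = (ω x p, ω y p, ω z p) := fun _ => rfl
  have hΦ : Topology.IsClosedEmbedding Φ := by
    apply LinearMap.isClosedEmbedding_of_injective
    rw [LinearMap.ker_eq_bot']
    intro p hp
    rw [hΦp, Prod.mk_eq_zero, Prod.mk_eq_zero] at hp
    exact hinj p hp.1 hp.2.1 hp.2.2
  let M := h p₁ + lx * c x + ly * c y + lz * c z
  let K : Set V := {p | (∀ e ∉ I, 0 ≤ c e + ω e p) ∧ h p ≤ h p₁}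
  have hclosed : IsClosed K := by
    have : K = (⋂ e, ⋂ (_ : e ∉ I), {p | 0 ≤ c e + ω e p}) ∩ {p | h p ≤ h p₁} := by
      ext p; simp [K]
    rw [this]
    refine IsClosed.inter (isClosed_iInter fun e => isClosed_iInter fun _ =>
      isClosed_le continuous_const (continuous_const.add (hcont _))) ?_
    exact isClosed_le (hcont _) continuous_const
  have hcompact : IsCompact K := by
    refine (hΦ.isCompact_preimage (isCompact_Icc (a := ((-c x, -c y, -c z) : ℝ × ℝ × ℝ))
      (b := (M / lx - c x, M / ly - c y, M / lz - c z)))).of_isClosed_subset hclosed ?_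
    rintro p ⟨hp, hp2⟩
    have h1 := hp x hx
    have h2 := hp y hy
    have h3 := hp z hz
    rw [hh] at hp2
    have m1 := mul_nonneg hlx.le h1
    have m2 := mul_nonneg hly.le h2
    have m3 := mul_nonneg hlz.le h3
    rw [Set.mem_preimage, hΦp, Set.mem_Icc, Prod.mk_le_mk, Prod.mk_le_mk, Prod.mk_le_mk,
      Prod.mk_le_mk]
    refine ⟨⟨by linarith, by linarith, by linarith⟩, ?_, ?_, ?_⟩
    · rw [le_sub_iff_add_le, le_div_iff₀ hlx]; simp only [M]; linarith
    · rw [le_sub_iff_add_le, le_div_iff₀ hly]; simp only [M]; linarith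
    · rw [le_sub_iff_add_le, le_div_iff₀ hlz]; simp only [M]; linarith
  obtain ⟨p, hpK, hmin⟩ := hcompact.exists_isMinOn ⟨p₁, hp₁, le_rfl⟩ (hcont h).continuousOn
  refine ⟨p, hpK.1, fun p' hp' => ?_⟩
  by_cases hle : h p' ≤ h p₁
  · exact hmin (show p' ∈ K from ⟨hp', hle⟩)
  · exact hpK.2.trans (not_le.1 hle).le

/-- Gale-dual criterion for a contraction to realize a simplicial complex as a complete fan. -/
theorem realizes_of_gale [Fintype ι] [DecidableEq ι] [FiniteDimensional ℝ V]
    {v : ι → W} {I : Set ι} {Δ : Set (Finset ι)}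
    {ω : ι → V →ₗ[ℝ] ℝ} {h : V →ₗ[ℝ] ℝ}
    (hdep : ∀ c : ι → ℝ, ∑ e, c e • v e = 0 ↔ ∃ p, ∀ e, c e = ω e p)
    (hempty : ∅ ∈ Δ) (hΔ : ∀ F ∈ Δ, ∀ e ∈ F, e ∉ I)
    (hcof : ∀ F ∈ Δ, ∃ x y z : ι, x ∉ I ∧ y ∉ I ∧ z ∉ I ∧ x ∉ F ∧ y ∉ F ∧ z ∉ F ∧
      ∃ lx ly lz : ℝ, 0 < lx ∧ 0 < ly ∧ 0 < lz ∧
        (∀ p, h p = lx * ω x p + ly * ω y p + lz * ω z p) ∧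
        ∀ p, ω x p = 0 → ω y p = 0 → ω z p = 0 → p = 0)
    (hpos : ∃ p₀, ∀ e ∉ I, 0 < ω e p₀)
    (hnon : ∀ F : Finset ι, (∀ e ∈ F, e ∉ I) → F ∉ Δ →
      ∃ u, (∀ e ∉ I, e ∉ F → 0 ≤ ω e u) ∧ h u < 0) :
    LinearIndepOn ℝ v I ∧ RealizesCompleteFan (contraction v I) Δ := by
  classical
  have hdep' := sum_contraction_eq_zero_iff (I := I) hdep
  refine ⟨?_, ?_, ?_, ?_⟩
  · obtain ⟨x, y, z, hx, hy, hz, -, -, -, _, _, _, -, -, -, -, hinj⟩ := hcof ∅ hempty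
    rw [linearIndepOn_iff]
    intro l hl h0
    rw [Finsupp.linearCombination_apply, Finsupp.sum_fintype _ _ (by simp)] at h0
    obtain ⟨p, hp⟩ := (hdep _).1 h0
    have hz0 : ∀ e ∉ I, ω e p = 0 := by
      intro e he
      rw [← hp]
      by_contra hne
      exact he (hl (by simpa using hne))
    have hp0 := hinj p (hz0 x hx) (hz0 y hy) (hz0 z hz)
    ext e
    rw [hp, hp0, map_zero]; rfl
  · intro F hF
    obtain ⟨x, y, z, hx, hy, hz, hxF, hyF, hzF, _, _, _, -, -, -, -, hinj⟩ := hcof F hF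
    rw [linearIndepOn_iff]
    intro l hl h0
    rw [Finsupp.linearCombination_apply, Finsupp.sum_fintype _ _ (by simp)] at h0
    obtain ⟨p, hp⟩ := (hdep' _).1 h0
    have hl0 : ∀ e ∉ F, l e = 0 := by
      intro e he
      by_contra hne
      exact he (hl (by simpa using hne))
    have hp0 := hinj p (by rw [← hp x hx, hl0 x hxF]) (by rw [← hp y hy, hl0 y hyF])
      (by rw [← hp z hz, hl0 z hzF])
    ext e
    by_cases he : e ∈ F
    · rw [hp e (hΔ F hF e he), hp0, map_zero]; rfl
    · rw [hl0 e he]; rfl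
  · intro F hF G hG
    ext w
    constructor
    · rintro ⟨⟨c, hc, rfl⟩, d, hd, hcd⟩
      obtain ⟨x, y, z, hx, hy, hz, hxF, hyF, hzF, l1, l2, l3, h1, h2, h3, hh, hinj⟩ := hcof F hF
      obtain ⟨x', y', z', hx', hy', hz', hxG, hyG, hzG, m1, m2, m3, g1, g2, g3, hh', -⟩ :=
        hcof G hG
      rw [← sum_extend, ← sum_extend _ G, ← sub_eq_zero, ← Finset.sum_sub_distrib] at hcd
      simp only [← sub_smul] at hcd
      -- Two representations of one vector differ by a dependency `p`, nonpositive outside `F` and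
      -- nonnegative outside `G`. Writing `h` by forms outside `G` gives `h p ≥ 0`, by forms outside
      -- `F` gives `h p ≤ 0`; so the forms outside `F` vanish and `p = 0`.
      obtain ⟨p, hp⟩ := (hdep' _).1 hcd
      have hnF : ∀ e ∉ I, e ∉ F → ω e p ≤ 0 := by
        intro e he heF
        rw [← hp e he, if_neg heF, zero_sub, neg_nonpos]
        split_ifs with heG
        exacts [hd e heG, le_rfl]
      have hnG : ∀ e ∉ I, e ∉ G → 0 ≤ ω e p := by
        intro e he heG
        rw [← hp e he, if_neg heG, sub_zero]
        split_ifs with heF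
        exacts [hc e heF, le_rfl]
      have hge : 0 ≤ h p := by
        rw [hh']
        have := mul_nonneg g1.le (hnG x' hx' hxG)
        have := mul_nonneg g2.le (hnG y' hy' hyG)
        have := mul_nonneg g3.le (hnG z' hz' hzG)
        linarith
      rw [hh] at hge
      have a1 := mul_nonpos_of_nonneg_of_nonpos h1.le (hnF x hx hxF)
      have a2 := mul_nonpos_of_nonneg_of_nonpos h2.le (hnF y hy hyF)
      have a3 := mul_nonpos_of_nonneg_of_nonpos h3.le (hnF z hz hzF)
      have hp0 : p = 0 := by
        refine hinj p ?_ ?_ ?_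
        · exact (mul_eq_zero.1 (by linarith : l1 * ω x p = 0)).resolve_left h1.ne'
        · exact (mul_eq_zero.1 (by linarith : l2 * ω y p = 0)).resolve_left h2.ne'
        · exact (mul_eq_zero.1 (by linarith : l3 * ω z p = 0)).resolve_left h3.ne'
      refine ⟨c, fun i hi => hc i (Finset.mem_inter.1 hi).1, ?_⟩
      symm
      refine Finset.sum_subset Finset.inter_subset_left fun e heF hne => ?_
      have heG : e ∉ G := fun hG' => hne (Finset.mem_inter.2 ⟨heF, hG'⟩)
      have := hp e (hΔ F hF e heF)
      rw [if_pos heF, if_neg heG, hp0, map_zero, sub_zero] at this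
      rw [this, zero_smul]
    · rintro ⟨c, hc, rfl⟩
      refine ⟨⟨fun e => if e ∈ F ∩ G then c e else 0, ?_, ?_⟩,
        ⟨fun e => if e ∈ F ∩ G then c e else 0, ?_, ?_⟩⟩
      · intro i _
        dsimp only
        split_ifs with hi
        exacts [hc i hi, le_rfl]
      · rw [← sum_extend, ← Finset.sum_subset (Finset.subset_univ F)]
        intro e _ he
        rw [if_neg (fun h' => he (Finset.mem_inter.1 h').1), zero_smul]
      · intro i _
        dsimp only
        split_ifs with hi
        exacts [hc i hi, le_rfl]
      · rw [← sum_extend, ← Finset.sum_subset (Finset.subset_univ G)]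
        intro e _ he
        rw [if_neg (fun h' => he (Finset.mem_inter.1 h').2), zero_smul]
  · refine Set.Subset.antisymm ?_ ?_
    · refine Set.iUnion₂_subset fun F hF => ?_
      rintro w ⟨c, -, rfl⟩
      exact Submodule.sum_mem _ fun e _ => Submodule.smul_mem _ _
        (Submodule.subset_span (Set.mem_range_self e))
    · intro w hw
      obtain ⟨c, rfl⟩ := (Submodule.mem_span_range_iff_exists_fun ℝ).1 hw
      obtain ⟨p₀, hp₀⟩ := hpos
      obtain ⟨x, y, z, hx, hy, hz, -, -, -, l1, l2, l3, h1, h2, h3, hh, hinj⟩ := hcof ∅ hempty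
      -- Adding a large multiple of the strictly positive dependency makes all coefficients outside
      -- `I` nonnegative without changing the vector.
      obtain ⟨t, ht⟩ : ∃ t : ℝ, ∀ e ∉ I, 0 ≤ c e + ω e (t • p₀) := by
        have : ∀ e, ∀ᶠ t : ℝ in Filter.atTop, e ∉ I → 0 ≤ c e + ω e (t • p₀) := by
          intro e
          by_cases he : e ∈ I
          · simp [he]
          filter_upwards [Filter.eventually_ge_atTop (-c e / ω e p₀)] with t ht _
          rw [div_le_iff₀ (hp₀ e he)] at ht
          rw [map_smul, smul_eq_mul]; linarith
        exact (Filter.eventually_all.2 this).exists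
      obtain ⟨p, hpK, hmin⟩ := exists_min_on_polyhedron hx hy hz h1 h2 h3 hh hinj c ht
      -- The support at the minimum. If it were not a face, `hnon` would give a direction that keeps
      -- the tight constraints and lowers `h`, contradicting minimality.
      let F : Finset ι := Finset.univ.filter fun e => e ∉ I ∧ 0 < c e + ω e p
      have hFI : ∀ e ∈ F, e ∉ I := fun e he => (Finset.mem_filter.1 he).2.1
      have htight : ∀ e ∉ I, e ∉ F → c e + ω e p = 0 := by
        intro e he heF
        refine le_antisymm (not_lt.1 fun hlt => heF ?_) (hpK e he)
        exact Finset.mem_filter.2 ⟨Finset.mem_univ _, he, hlt⟩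
      have hF : F ∈ Δ := by
        by_contra hF
        obtain ⟨u, hu, hu2⟩ := hnon F hFI hF
        have : ∀ e, ∀ᶠ s : ℝ in nhdsWithin 0 (Set.Ioi 0), e ∉ I → 0 ≤ c e + ω e (p + s • u) := by
          intro e
          by_cases he : e ∈ I
          · simp [he]
          by_cases heF : e ∈ F
          · have hlt : 0 < c e + ω e p := (Finset.mem_filter.1 heF).2.2
            have hc : Filter.Tendsto (fun s : ℝ => c e + ω e p + s * ω e u)
                (nhdsWithin 0 (Set.Ioi 0)) (nhds (c e + ω e p + 0 * ω e u)) :=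
              ((continuous_const.add (continuous_id.mul continuous_const)).tendsto 0).mono_left
                nhdsWithin_le_nhds
            rw [zero_mul, add_zero] at hc
            filter_upwards [hc.eventually (lt_mem_nhds hlt)] with s hs _
            rw [map_add, map_smul, smul_eq_mul]; linarith
          · filter_upwards [self_mem_nhdsWithin] with s hs _
            rw [map_add, map_smul, smul_eq_mul, ← add_assoc, htight e he heF, zero_add]
            exact mul_nonneg (le_of_lt hs) (hu e he heF)
        obtain ⟨s, hs, hs0⟩ :=
          ((Filter.eventually_all.2 this).and self_mem_nhdsWithin).exists
        have := hmin _ hs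
        rw [map_add, map_smul, smul_eq_mul] at this
        have := mul_neg_of_pos_of_neg (Set.mem_Ioi.1 hs0) hu2
        linarith
      refine Set.mem_iUnion₂.2 ⟨F, hF, fun e => c e + ω e p,
        fun e he => (Finset.mem_filter.1 he).2.2.le, ?_⟩
      have h0 := (hdep' (fun e => ω e p)).2 ⟨p, fun _ _ => rfl⟩
      have : ∑ e, c e • contraction v I e = ∑ e, (c e + ω e p) • contraction v I e := by
        simp only [add_smul, Finset.sum_add_distrib]; rw [h0, add_zero]
      rw [this]
      symm
      refine Finset.sum_subset (Finset.subset_univ F) fun e _ heF => ?_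
      by_cases he : e ∈ I
      · rw [contraction_eq_zero he, smul_zero]
      · dsimp only
        rw [htight e he heF, zero_smul]

end Gale

end Multiassociahedron
namespace Multiassociahedron

/-! ### Linear dependencies among the rows of the cofactor matrix -/

section Dependencies

/-- The determinant of two plane vectors. -/
def det2 (u v : ℝ × ℝ) : ℝ := u.1 * v.2 - u.2 * v.1

/-- The linear form `p ↦ det ((a, 1), (b, 1), p)` on `ℝ³`. -/
def lineForm (a b : ℝ × ℝ) : ℝ × ℝ × ℝ →ₗ[ℝ] ℝ where
  toFun p := (a.1 * b.2 - a.2 * b.1) * p.2.2 + (a.2 - b.2) * p.1 + (b.1 - a.1) * p.2.1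
  map_add' p p' := by simp only [Prod.fst_add, Prod.snd_add]; ring
  map_smul' c p := by simp only [Prod.smul_fst, Prod.smul_snd, smul_eq_mul, RingHom.id_apply]; ring

theorem lineForm_apply (a b : ℝ × ℝ) (p : ℝ × ℝ × ℝ) : lineForm a b p =
    (a.1 * b.2 - a.2 * b.1) * p.2.2 + (a.2 - b.2) * p.1 + (b.1 - a.1) * p.2.1 := rfl

theorem lineForm_point (a b p : ℝ × ℝ) : lineForm a b (p.1, p.2, 1) = orient a b p := by
  simp only [lineForm_apply, orient]; ring

theorem lineForm_swap (a b : ℝ × ℝ) (p : ℝ × ℝ × ℝ) : lineForm b a p = - lineForm a b p := by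
  simp only [lineForm_apply]; ring

theorem orient_swap (a b c : ℝ × ℝ) : orient b a c = - orient a b c := by
  simp only [orient]; ring

/-- Homogeneous form of the vanishing of divided differences of low degree polynomials: the product
of linear forms has degree two less than the number of nodes. -/
theorem sum_prod_div_det2_eq_zero {ι : Type*} [DecidableEq ι] (a : ι → ℝ × ℝ) :
    ∀ (L : List (ℝ × ℝ)) (J : Finset ι), J.card = L.length + 2 →
      (∀ i ∈ J, ∀ j ∈ J, i ≠ j → det2 (a i) (a j) ≠ 0) →
      ∑ j ∈ J, (L.map fun u => det2 u (a j)).prod / ∏ l ∈ J.erase j, det2 (a j) (a l) = 0 := by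
  intro L
  induction L with
  | nil =>
    intro J hJ hne
    obtain ⟨x, y, hxy, rfl⟩ := Finset.card_eq_two.1 hJ
    have h1 : ({x, y} : Finset ι).erase x = {y} := by ext; simp; grind
    have h2 : ({x, y} : Finset ι).erase y = {x} := by ext; simp; grind
    rw [Finset.sum_pair hxy, h1, h2]
    have h3 := hne x (by simp) y (by simp) hxy
    have h4 : det2 (a y) (a x) = - det2 (a x) (a y) := by simp only [det2]; ring
    simp [h4, div_neg]
  | cons u L ih =>
    intro J hJ hne
    -- A factor vanishing at the node `r` removes that node and cancels its factor in every other
    -- denominator, leaving the induction hypothesis on `J.erase r`.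
    have hstep : ∀ r ∈ J, ∑ j ∈ J, det2 (a j) (a r) * (L.map fun u => det2 u (a j)).prod
        / ∏ l ∈ J.erase j, det2 (a j) (a l) = 0 := by
      intro r hr
      rw [← Finset.add_sum_erase J _ hr]
      have h0 : det2 (a r) (a r) = 0 := by simp only [det2]; ring
      rw [h0, zero_mul, zero_div, zero_add]
      have := ih (J.erase r) (by rw [Finset.card_erase_of_mem hr, hJ]; simp)
        (fun i hi j hj => hne i (Finset.mem_of_mem_erase hi) j (Finset.mem_of_mem_erase hj))
      rw [← this]
      refine Finset.sum_congr rfl fun j hj => ?_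
      have hjr := Finset.ne_of_mem_erase hj
      have hjJ := Finset.mem_of_mem_erase hj
      rw [Finset.erase_right_comm, ← Finset.mul_prod_erase (J.erase j) _
        (Finset.mem_erase.2 ⟨hjr.symm, hr⟩), mul_div_mul_left _ _ (hne j hjJ r hr hjr)]
    have hcard : 1 < J.card := by rw [hJ]; omega
    obtain ⟨x, hx, y, hy, hxy⟩ := Finset.one_lt_card.1 hcard
    have hD := hne x hx y hy hxy
    -- An arbitrary linear form is a combination of those vanishing at two independent nodes, so
    -- `hstep` at `x` and `y` suffices.
    have hlin : ∀ z, det2 u z = (det2 u (a y) / det2 (a x) (a y)) * -det2 z (a x)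
        + (det2 u (a x) / det2 (a x) (a y)) * det2 z (a y) := by
      intro z
      rw [div_mul_eq_mul_div, div_mul_eq_mul_div, ← add_div, eq_div_iff hD]
      simp only [det2]; ring
    have := congrArg₂ (fun s t => -(det2 u (a y) / det2 (a x) (a y)) * s
      + (det2 u (a x) / det2 (a x) (a y)) * t) (hstep x hx) (hstep y hy)
    simp only [mul_zero, add_zero] at this
    rw [← this, Finset.mul_sum, Finset.mul_sum, ← Finset.sum_add_distrib]
    refine Finset.sum_congr rfl fun j _ => ?_
    rw [List.map_cons, List.prod_cons, hlin (a j)]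
    ring

/-- If weights annihilate all monomials of a given degree, they annihilate all products of linear
forms of that degree. -/
theorem sum_mul_prod_det2_eq_zero {ι : Type*} [Fintype ι] (a : ι → ℝ × ℝ) (w : ι → ℝ) (N : ℕ)
    (hw : ∀ s r, s + r = N → ∑ j, w j * ((a j).2 ^ s * (a j).1 ^ r) = 0) :
    ∀ L : List (ℝ × ℝ), ∀ s r, L.length + s + r = N →
      ∑ j, w j * ((L.map fun u => det2 u (a j)).prod * ((a j).2 ^ s * (a j).1 ^ r)) = 0 := by
  intro L
  induction L with
  | nil => intro s r h; simpa using hw s r (by simpa using h)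
  | cons u L ih =>
    intro s r h
    rw [List.length_cons] at h
    have := congrArg₂ (fun x y => u.1 * x - u.2 * y) (ih (s + 1) r (by omega))
      (ih s (r + 1) (by omega))
    simp only [mul_zero, sub_zero] at this
    rw [← this, Finset.mul_sum, Finset.mul_sum, ← Finset.sum_sub_distrib]
    refine Finset.sum_congr rfl fun j _ => ?_
    rw [List.map_cons, List.prod_cons]
    simp only [det2]; ring

variable {n : ℕ}

/-- The symmetric function on ordered pairs of vertices given by a function on edges. -/
def pairWeight (c : Edge n → ℝ) (i j : Fin n) : ℝ :=
  if h : i < j then c ⟨(i, j), h⟩ else if h : j < i then c ⟨(j, i), h⟩ else 0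

theorem pairWeight_symm (c : Edge n → ℝ) (i j : Fin n) : pairWeight c i j = pairWeight c j i := by
  unfold pairWeight
  split_ifs with h1 h2 <;> first | rfl | exact absurd h1 (lt_asymm h2)

theorem pairWeight_self (c : Edge n → ℝ) (i : Fin n) : pairWeight c i i = 0 := by
  simp [pairWeight]

theorem pairWeight_edge (c : Edge n → ℝ) (e : Edge n) : pairWeight c e.fst e.snd = c e := by
  unfold pairWeight
  rw [dif_pos e.2]

/-- The entries are homogeneous of odd degree `d - 1`. The sign in the block of the larger endpoint
is thereby absorbed, so both endpoints of an edge play the same role in `sum_row_apply`. -/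
theorem cofactorVector_swap {d : ℕ} (hd : Even d) (hd0 : 0 < d) (q : Fin n → ℝ × ℝ) (i j : Fin n)
    (t : Fin d) : cofactorVector d q j i t = - cofactorVector d q i j t := by
  unfold cofactorVector
  rw [← neg_sub (q i).2, ← neg_sub (q i).1, neg_pow, neg_pow ((q i).1 - (q j).1)]
  have h : ((-1 : ℝ) ^ (t : ℕ)) * (-1) ^ (d - 1 - (t : ℕ)) = -1 := by
    rw [← pow_add]
    have ht := t.2
    apply Odd.neg_one_pow
    obtain ⟨m, rfl⟩ := hd
    exact ⟨m - 1, by omega⟩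
  linear_combination ((q i).2 - (q j).2) ^ (t : ℕ) * ((q i).1 - (q j).1) ^ (d - 1 - (t : ℕ)) * h

theorem sum_row_apply {d : ℕ} (hd : Even d) (hd0 : 0 < d) (q : Fin n → ℝ × ℝ) (c : Edge n → ℝ)
    (i : Fin n) (t : Fin d) : ∑ e, c e * cofactorMatrix d q e (i, t) =
      ∑ j, pairWeight c i j * cofactorVector d q i j t := by
  let g : Fin n × Fin n → ℝ := fun x => pairWeight c x.1 x.2 *
    (if i = x.1 then cofactorVector d q x.1 x.2 t
    else if i = x.2 then - cofactorVector d q x.1 x.2 t else 0)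
  have h1 : ∑ e, c e * cofactorMatrix d q e (i, t) = ∑ e : Edge n, g e.1 := by
    refine Finset.sum_congr rfl fun e _ => ?_
    simp only [g]
    rw [pairWeight_edge]
    rfl
  rw [h1, ← Finset.sum_subtype (Finset.univ.filter fun x : Fin n × Fin n => x.1 < x.2)
    (by simp) g, Finset.sum_filter, Fintype.sum_prod_type]
  have h2 : ∀ x y : Fin n, (if x < y then g (x, y) else 0) =
      (if i = x then (if i < y then pairWeight c i y * cofactorVector d q i y t else 0) else 0) +
      (if i = y then (if x < i then pairWeight c i x * cofactorVector d q i x t else 0) else 0) := by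
    intro x y
    simp only [g]
    by_cases hxy : x < y
    · by_cases hix : i = x
      · subst hix
        simp [hxy, hxy.ne]
      · by_cases hiy : i = y
        · subst hiy
          simp [hxy, hix, pairWeight_symm c x i, cofactorVector_swap hd hd0 q i x]
        · simp [hxy, hix, hiy]
    · rw [if_neg hxy]
      by_cases hix : i = x
      · subst hix; simp [hxy]
      · by_cases hiy : i = y
        · subst hiy; simp [hxy]
        · simp [hix, hiy]
  simp only [h2, Finset.sum_add_distrib]
  rw [Finset.sum_comm]
  simp only [Finset.sum_ite_eq, Finset.mem_univ, if_true]
  rw [← Finset.sum_add_distrib]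
  refine Finset.sum_congr rfl fun j _ => ?_
  rcases lt_trichotomy i j with h | h | h
  · simp [h, h.not_gt]
  · subst h; simp [pairWeight_self]
  · simp [h, h.not_gt]

theorem sum_row_eq_zero_iff {d : ℕ} (hd : Even d) (hd0 : 0 < d) (q : Fin n → ℝ × ℝ)
    (c : Edge n → ℝ) : ∑ e, c e • (cofactorMatrix d q).row e = 0 ↔
      ∀ i t, ∑ j, pairWeight c i j * cofactorVector d q i j t = 0 := by
  rw [funext_iff]
  simp only [Prod.forall, Finset.sum_apply, Pi.smul_apply, Matrix.row_apply, smul_eq_mul,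
    Pi.zero_apply, sum_row_apply hd hd0]

/-- The coefficient form of an edge: as `p` varies, the values of these forms are exactly the linear
dependencies among the rows of the cofactor matrix of `d + 3` points. -/
noncomputable def edgeForm (q : Fin n → ℝ × ℝ) (e : Edge n) : ℝ × ℝ × ℝ →ₗ[ℝ] ℝ :=
  (∏ l ∈ (Finset.univ.erase e.fst).erase e.snd, orient (q e.fst) (q e.snd) (q l))⁻¹ •
    lineForm (q e.fst) (q e.snd)

/-- Each of the `n - 2` factors changes sign, and `n - 2` is odd. As `lineForm` is skew too, the
quotient of the two is a symmetric weight. -/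
theorem prod_orient_swap (hn : Odd n) (q : Fin n → ℝ × ℝ) {i j : Fin n} (hij : i ≠ j) :
    ∏ l ∈ (Finset.univ.erase j).erase i, orient (q j) (q i) (q l)
      = - ∏ l ∈ (Finset.univ.erase i).erase j, orient (q i) (q j) (q l) := by
  rw [Finset.erase_right_comm]
  simp only [fun l => orient_swap (q i) (q j) (q l)]
  rw [Finset.prod_neg, Finset.card_erase_of_mem (by simpa using hij.symm),
    Finset.card_erase_of_mem (Finset.mem_univ _), Finset.card_univ, Fintype.card_fin]
  have : i.1 ≠ j.1 := fun h => hij (Fin.ext h)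
  have := i.2
  have := j.2
  rw [Odd.neg_one_pow, neg_one_mul]
  obtain ⟨m, rfl⟩ := hn
  exact ⟨m - 1, by omega⟩

theorem pairWeight_edgeForm (hn : Odd n) (q : Fin n → ℝ × ℝ) (p : ℝ × ℝ × ℝ) {i j : Fin n}
    (hij : i ≠ j) : pairWeight (fun e => edgeForm q e p) i j = lineForm (q i) (q j) p /
      ∏ l ∈ (Finset.univ.erase i).erase j, orient (q i) (q j) (q l) := by
  unfold pairWeight edgeForm
  rcases lt_or_gt_of_ne hij with h | h
  · rw [dif_pos h]
    dsimp only
    rw [LinearMap.smul_apply, smul_eq_mul, div_eq_inv_mul]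
  · rw [dif_neg h.not_gt, dif_pos h]
    dsimp only
    rw [LinearMap.smul_apply, smul_eq_mul, div_eq_inv_mul, prod_orient_swap hn q hij, lineForm_swap, inv_neg, neg_mul_neg]

/-- Seen from vertex `i`, the sum is a divided difference on the `d + 2` vectors `q i - q j`: the
numerator is a product of `d` linear forms, one from `p` and `d - 1` coordinates from the cofactor
vector, so `sum_prod_div_det2_eq_zero` applies. -/
theorem edgeForm_dependency {d : ℕ} (hd : Even d) (hd0 : 0 < d) (hn : n = d + 3)
    (q : Fin n → ℝ × ℝ)
    (hq : ∀ i j l : Fin n, i ≠ j → i ≠ l → j ≠ l → orient (q i) (q j) (q l) ≠ 0)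
    (p : ℝ × ℝ × ℝ) (i : Fin n) (t : Fin d) :
    ∑ j, pairWeight (fun e => edgeForm q e p) i j * cofactorVector d q i j t = 0 := by
  have hodd : Odd n := by rw [hn]; exact hd.add_odd ⟨1, rfl⟩
  let a : Fin n → ℝ × ℝ := fun j => q i - q j
  -- Chosen so that `lineForm (q i) (q j) p = det2 u (a j)`: it is `p` projected from the point `q
  -- i`.
  let u : ℝ × ℝ := (p.1 - p.2.2 * (q i).1, p.2.1 - p.2.2 * (q i).2)
  have ht := t.2
  have key := sum_prod_div_det2_eq_zero a
    (u :: (List.replicate t (1, 0) ++ List.replicate (d - 1 - t) (0, -1))) (Finset.univ.erase i)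
    (by
      rw [Finset.card_erase_of_mem (Finset.mem_univ _), Finset.card_univ, Fintype.card_fin]
      simp only [List.length_cons, List.length_append, List.length_replicate]; omega)
    (by
      intro x hx y hy hxy
      have := hq i x y (Finset.ne_of_mem_erase hx).symm (Finset.ne_of_mem_erase hy).symm hxy
      contrapose! this
      rw [← this]
      simp only [a, det2, orient, Prod.fst_sub, Prod.snd_sub]; ring)
  rw [← Finset.add_sum_erase _ _ (Finset.mem_univ i), pairWeight_self, zero_mul, zero_add, ← key]
  refine Finset.sum_congr rfl fun j hj => ?_
  rw [pairWeight_edgeForm hodd q p (Finset.ne_of_mem_erase hj).symm]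
  have h1 : ∀ l, orient (q i) (q j) (q l) = det2 (a j) (a l) := by
    intro l; simp only [a, det2, orient, Prod.fst_sub, Prod.snd_sub]; ring
  simp only [h1]
  rw [List.map_cons, List.prod_cons, List.map_append, List.prod_append, List.map_replicate,
    List.map_replicate, List.prod_replicate, List.prod_replicate]
  have h2 : lineForm (q i) (q j) p = det2 u (a j) := by
    simp only [lineForm_apply, det2, u, a, Prod.fst_sub, Prod.snd_sub]; ring
  have h3 : det2 (1, 0) (a j) = (q i).2 - (q j).2 := by simp [det2, a]
  have h4 : det2 (0, -1) (a j) = (q i).1 - (q j).1 := by simp [det2, a]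
  rw [h2, h3, h4]
  unfold cofactorVector
  ring

/-- A skew function on pairs of points satisfying the three-term relations comes from a point of
the projective plane. -/
theorem exists_lineForm_eq (q : Fin n → ℝ × ℝ) (m : Fin n → Fin n → ℝ)
    (hskew : ∀ i j, i ≠ j → m j i = - m i j)
    (hrel : ∀ i j l r, i ≠ j → i ≠ l → i ≠ r → j ≠ l → j ≠ r → l ≠ r →
      m i j * orient (q i) (q l) (q r) - m i l * orient (q i) (q j) (q r)
        + m i r * orient (q i) (q j) (q l) = 0)
    (hq : ∀ i j l : Fin n, i ≠ j → i ≠ l → j ≠ l → orient (q i) (q j) (q l) ≠ 0)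
    {x y z : Fin n} (hxy : x ≠ y) (hxz : x ≠ z) (hyz : y ≠ z) :
    ∃ p, ∀ i j, i ≠ j → m i j = lineForm (q i) (q j) p := by
  have hO := hq x y z hxy hxz hyz
  -- Cramer's rule: the point whose line forms agree with `m` on the three pairs from `x, y, z`. The
  -- difference `m'` satisfies the same relations, which spread its zeros from these pairs to all
  -- pairs.
  let p : ℝ × ℝ × ℝ := (orient (q x) (q y) (q z))⁻¹ • (m y z • ((q x).1, (q x).2, (1 : ℝ)) -
    m x z • ((q y).1, (q y).2, (1 : ℝ)) + m x y • ((q z).1, (q z).2, (1 : ℝ)))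
  have hp : ∀ a b, lineForm a b p = (orient (q x) (q y) (q z))⁻¹ * (m y z * orient a b (q x) -
      m x z * orient a b (q y) + m x y * orient a b (q z)) := by
    intro a b
    simp only [p, map_smul, map_sub, map_add, lineForm_point, smul_eq_mul]
  let m' : Fin n → Fin n → ℝ := fun i j => m i j - lineForm (q i) (q j) p
  have hskew' : ∀ i j, i ≠ j → m' j i = - m' i j := by
    intro i j hij
    simp only [m', hskew i j hij, lineForm_swap (q i) (q j)]; ring
  have hrel' : ∀ i j l r, i ≠ j → i ≠ l → i ≠ r → j ≠ l → j ≠ r → l ≠ r →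
      m' i j * orient (q i) (q l) (q r) - m' i l * orient (q i) (q j) (q r)
        + m' i r * orient (q i) (q j) (q l) = 0 := by
    intro i j l r h1 h2 h3 h4 h5 h6
    have := hrel i j l r h1 h2 h3 h4 h5 h6
    have h0 : lineForm (q i) (q j) p * orient (q i) (q l) (q r)
        - lineForm (q i) (q l) p * orient (q i) (q j) (q r)
        + lineForm (q i) (q r) p * orient (q i) (q j) (q l) = 0 := by
      simp only [lineForm_apply, orient]; ring
    simp only [m']; linear_combination this - h0
  have hxy0 : m' x y = 0 := by
    simp only [m', hp]
    have h1 : orient (q x) (q y) (q x) = 0 := by simp only [orient]; ring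
    have h2 : orient (q x) (q y) (q y) = 0 := by simp only [orient]; ring
    rw [h1, h2]; field_simp; ring
  have hxz0 : m' x z = 0 := by
    simp only [m', hp]
    have h1 : orient (q x) (q z) (q x) = 0 := by simp only [orient]; ring
    have h2 : orient (q x) (q z) (q z) = 0 := by simp only [orient]; ring
    have h3 : orient (q x) (q z) (q y) = -orient (q x) (q y) (q z) := by simp only [orient]; ring
    rw [h1, h2, h3]; field_simp; ring
  have hyz0 : m' y z = 0 := by
    simp only [m', hp]
    have h1 : orient (q y) (q z) (q y) = 0 := by simp only [orient]; ring
    have h2 : orient (q y) (q z) (q z) = 0 := by simp only [orient]; ring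
    have h3 : orient (q y) (q z) (q x) = orient (q x) (q y) (q z) := by simp only [orient]; ring
    rw [h1, h2, h3]; field_simp; ring
  have hx0 : ∀ r, x ≠ r → m' x r = 0 := by
    intro r hr
    by_cases h1 : y = r
    · exact h1 ▸ hxy0
    by_cases h2 : z = r
    · exact h2 ▸ hxz0
    have := hrel' x y z r hxy hxz hr hyz h1 h2
    rw [hxy0, hxz0] at this
    simpa [hO] using this
  have hy0 : ∀ r, y ≠ r → m' y r = 0 := by
    intro r hr
    by_cases h1 : x = r
    · rw [← h1, hskew' x y hxy, hxy0, neg_zero]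
    by_cases h2 : z = r
    · exact h2 ▸ hyz0
    have := hrel' y x z r hxy.symm hyz hr hxz h1 h2
    rw [hskew' x y hxy, hxy0, hyz0] at this
    simpa [hq y x z hxy.symm hyz hxz] using this
  refine ⟨p, fun i j hij => sub_eq_zero.1 (?_ : m' i j = 0)⟩
  by_cases h1 : x = i
  · subst h1; exact hx0 j hij
  by_cases h2 : y = i
  · subst h2; exact hy0 j hij
  have hix : m' i x = 0 := by rw [hskew' x i h1, hx0 i h1, neg_zero]
  have hiy : m' i y = 0 := by rw [hskew' y i h2, hy0 i h2, neg_zero]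
  by_cases h3 : x = j
  · exact h3 ▸ hix
  by_cases h4 : y = j
  · exact h4 ▸ hiy
  have := hrel' i x y j (Ne.symm h1) (Ne.symm h2) hij hxy h3 h4
  rw [hix, hiy] at this
  simpa [hq i x y (Ne.symm h1) (Ne.symm h2) hxy] using this

/-- Test the weights against the product of the `d - 1` linear forms vanishing at all vertices other
than `i, j, l, r`. Only the terms of `j, l, r` survive; multiplying by the three orientations of
these vertices with `i` restores the full products. -/
theorem three_term_relation {d : ℕ} (hd : Even d) (hd0 : 0 < d) (hn : n = d + 3)
    (q : Fin n → ℝ × ℝ) (w : Fin n → ℝ) (i : Fin n) (hwi : w i = 0)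
    (hw : ∀ t, ∑ j, w j * cofactorVector d q i j t = 0)
    {j l r : Fin n} (hij : i ≠ j) (hil : i ≠ l) (hir : i ≠ r) (hjl : j ≠ l) (hjr : j ≠ r)
    (hlr : l ≠ r) :
    (w j * ∏ s ∈ (Finset.univ.erase i).erase j, orient (q i) (q j) (q s)) *
        orient (q i) (q l) (q r)
      - (w l * ∏ s ∈ (Finset.univ.erase i).erase l, orient (q i) (q l) (q s)) *
        orient (q i) (q j) (q r)
      + (w r * ∏ s ∈ (Finset.univ.erase i).erase r, orient (q i) (q r) (q s)) *
        orient (q i) (q j) (q l) = 0 := by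
  let a : Fin n → ℝ × ℝ := fun j => q i - q j
  let S : Finset (Fin n) := Finset.univ \ {i, j, l, r}
  have hcard : S.card = d - 1 := by
    have : ({i, j, l, r} : Finset (Fin n)).card = 4 := by
      rw [Finset.card_insert_of_notMem, Finset.card_insert_of_notMem,
        Finset.card_insert_of_notMem, Finset.card_singleton] <;> simp_all
    rw [Finset.card_sdiff_of_subset (Finset.subset_univ _), this, Finset.card_univ,
      Fintype.card_fin]
    omega
  have key := sum_mul_prod_det2_eq_zero a w (d - 1) (by
    intro s r' hsr
    have := hw ⟨s, by omega⟩
    rw [← this]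
    refine Finset.sum_congr rfl fun x _ => ?_
    simp only [cofactorVector, a, Prod.fst_sub, Prod.snd_sub]
    rw [show d - 1 - s = r' by omega]) (S.toList.map a) 0 0 (by
      rw [List.length_map, Finset.length_toList, hcard, add_zero, add_zero])
  simp only [pow_zero, mul_one, List.map_map] at key
  have hprod : ∀ x, (S.toList.map ((fun u => det2 u (a x)) ∘ a)).prod
      = ∏ s ∈ S, det2 (a s) (a x) := fun x => Finset.prod_map_toList S _
  simp only [hprod] at key
  have hsum : w j * ∏ s ∈ S, det2 (a s) (a j) + w l * ∏ s ∈ S, det2 (a s) (a l)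
      + w r * ∏ s ∈ S, det2 (a s) (a r) = 0 := by
    rw [← Finset.sum_subset (Finset.subset_univ {j, l, r})] at key
    · rw [Finset.sum_insert (by simp [hjl, hjr]), Finset.sum_pair hlr] at key
      linarith
    · intro x _ hx
      by_cases hxi : x = i
      · rw [hxi, hwi, zero_mul]
      · have hxS : x ∈ S := by simp_all [S]
        rw [Finset.prod_eq_zero hxS (by simp only [det2]; ring), mul_zero]
  have hneg : ∀ x, ∏ s ∈ S, orient (q i) (q x) (q s) = - ∏ s ∈ S, det2 (a s) (a x) := by
    intro x
    have : ∀ s, orient (q i) (q x) (q s) = - det2 (a s) (a x) := by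
      intro s; simp only [a, det2, orient, Prod.fst_sub, Prod.snd_sub]; ring
    simp only [this]
    rw [Finset.prod_neg, hcard, Odd.neg_one_pow, neg_one_mul]
    obtain ⟨m, rfl⟩ := hd
    exact ⟨m - 1, by omega⟩
  have hsplit : ∀ x y z : Fin n, x ≠ y → x ≠ z → y ≠ z → i ≠ y → i ≠ z →
      (Finset.univ \ {i, x, y, z} : Finset (Fin n)) = S →
      ∏ s ∈ (Finset.univ.erase i).erase x, orient (q i) (q x) (q s)
        = orient (q i) (q x) (q y) * (orient (q i) (q x) (q z) *
          ∏ s ∈ S, orient (q i) (q x) (q s)) := by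
    intro x y z hxy hxz hyz hiy hiz hS
    rw [← hS, ← Finset.mul_prod_erase _ _ (show y ∈ (Finset.univ.erase i).erase x by
      simp [hxy.symm, hiy.symm]), ← Finset.mul_prod_erase _ _ (show z ∈
      ((Finset.univ.erase i).erase x).erase y by simp [hxz.symm, hiz.symm, hyz.symm])]
    congr 3
    ext s
    simp; tauto
  rw [hsplit j l r hjl hjr hlr hil hir rfl,
    hsplit l j r hjl.symm hlr hjr hij hir (by ext; simp [S]; tauto),
    hsplit r j l hjr.symm hlr.symm hjl hij hil (by ext; simp [S]; tauto), hneg, hneg, hneg]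
  have o1 : orient (q i) (q l) (q j) = - orient (q i) (q j) (q l) := by simp only [orient]; ring
  have o2 : orient (q i) (q r) (q j) = - orient (q i) (q j) (q r) := by simp only [orient]; ring
  have o3 : orient (q i) (q r) (q l) = - orient (q i) (q l) (q r) := by simp only [orient]; ring
  rw [o1, o2, o3]
  linear_combination (-orient (q i) (q j) (q l) * orient (q i) (q j) (q r)
    * orient (q i) (q l) (q r)) * hsum

/-- The linear dependencies among the rows of the cofactor matrix of `d + 3` points in general
position, `d` even. -/
theorem sum_row_eq_zero_iff_exists {d : ℕ} (hd : Even d) (hd0 : 0 < d) (hn : n = d + 3)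
    (q : Fin n → ℝ × ℝ)
    (hq : ∀ i j l : Fin n, i ≠ j → i ≠ l → j ≠ l → orient (q i) (q j) (q l) ≠ 0)
    (c : Edge n → ℝ) :
    ∑ e, c e • (cofactorMatrix d q).row e = 0 ↔ ∃ p, ∀ e, c e = edgeForm q e p := by
  have hodd : Odd n := by rw [hn]; exact hd.add_odd ⟨1, rfl⟩
  have hne : ∀ i j : Fin n, i ≠ j →
      ∏ l ∈ (Finset.univ.erase i).erase j, orient (q i) (q j) (q l) ≠ 0 := by
    intro i j hij
    refine Finset.prod_ne_zero_iff.2 fun l hl => hq i j l hij ?_ ?_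
    · exact (Finset.ne_of_mem_erase (Finset.mem_of_mem_erase hl)).symm
    · exact (Finset.ne_of_mem_erase hl).symm
  rw [sum_row_eq_zero_iff hd hd0]
  constructor
  · intro h
    obtain ⟨p, hp⟩ := exists_lineForm_eq q
      (fun i j => pairWeight c i j * ∏ l ∈ (Finset.univ.erase i).erase j,
        orient (q i) (q j) (q l))
      (fun i j hij => by rw [prod_orient_swap hodd q hij, pairWeight_symm, mul_neg])
      (fun i j l r h1 h2 h3 h4 h5 h6 => three_term_relation hd hd0 hn q (pairWeight c i) i
        (pairWeight_self c i) (h i) h1 h2 h3 h4 h5 h6) hq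
      (x := ⟨0, by omega⟩) (y := ⟨1, by omega⟩) (z := ⟨2, by omega⟩)
      (by simp) (by simp) (by simp)
    refine ⟨p, fun e => ?_⟩
    have := hp e.fst e.snd e.2.ne
    rw [edgeForm, LinearMap.smul_apply, smul_eq_mul, ← this, pairWeight_edge, mul_comm (c e),
      inv_mul_cancel_left₀ (hne _ _ e.2.ne)]
  · rintro ⟨p, hp⟩ i t
    rw [funext hp]
    exact edgeForm_dependency hd hd0 hn q hq p i t

end Dependencies

end Multiassociahedron
namespace Multiassociahedron

/-! ### Combinatorics of the relevant edges of the `(2k+3)`-gon -/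

section Combinatorics

/-- Turns index arithmetic around the cycle into two linear cases that `omega` can handle. -/
theorem add_mod_cases {n : ℕ} (i m : ℕ) (hm : m ≤ n) (hn : 0 < n) :
    (i % n + m < n ∧ (i + m) % n = i % n + m) ∨
      (n ≤ i % n + m ∧ (i + m) % n + n = i % n + m) := by
  have hi := Nat.mod_lt i hn
  rw [← Nat.mod_add_mod]
  rcases lt_or_ge (i % n + m) n with h | h
  · exact Or.inl ⟨h, Nat.mod_eq_of_lt h⟩
  · refine Or.inr ⟨h, ?_⟩
    rw [Nat.mod_eq_sub_mod h, Nat.mod_eq_of_lt (by omega)]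
    omega

theorem exists_modEq_add {n : ℕ} (hn : 0 < n) (a j : ℕ) : ∃ i < n, (j + i) % n = a % n := by
  refine ⟨(a + (n - 1) * j) % n, Nat.mod_lt _ hn, ?_⟩
  rw [Nat.add_mod_mod]
  obtain ⟨m, rfl⟩ : ∃ m, n = m + 1 := ⟨n - 1, by omega⟩
  rw [Nat.add_sub_cancel, show j + (a + m * j) = a + j * (m + 1) by ring,
    Nat.add_mul_mod_self_right]

variable {k : ℕ}

/-- The relevant edge joining the vertices `i` and `i + k + 1`, modulo `2k + 3`. -/
def relEdge (k i : ℕ) : Edge (2 * k + 3) :=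
  if h : i % (2 * k + 3) ≤ k + 1 then
    ⟨(⟨i % (2 * k + 3), by omega⟩, ⟨i % (2 * k + 3) + k + 1, by omega⟩), by
      rw [Fin.lt_def]; dsimp only; omega⟩
  else ⟨(⟨i % (2 * k + 3) - (k + 2), by
      have := Nat.mod_lt i (show 0 < 2 * k + 3 by omega); omega⟩,
    ⟨i % (2 * k + 3), Nat.mod_lt _ (by omega)⟩), by
      rw [Fin.lt_def]; dsimp only; omega⟩

theorem relEdge_cases (k i : ℕ) :
    i % (2 * k + 3) < 2 * k + 3 ∧
    ((i % (2 * k + 3) ≤ k + 1 ∧ ((relEdge k i).fst : ℕ) = i % (2 * k + 3) ∧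
      ((relEdge k i).snd : ℕ) = i % (2 * k + 3) + k + 1) ∨
    (k + 2 ≤ i % (2 * k + 3) ∧ ((relEdge k i).fst : ℕ) + (k + 2) = i % (2 * k + 3) ∧
      ((relEdge k i).snd : ℕ) = i % (2 * k + 3))) := by
  have hlt := Nat.mod_lt i (show 0 < 2 * k + 3 by omega)
  refine ⟨hlt, ?_⟩
  unfold relEdge
  split_ifs with h
  · exact Or.inl ⟨h, rfl, rfl⟩
  · refine Or.inr ⟨by omega, ?_, rfl⟩
    dsimp only; omega

theorem relevant_iff (e : Edge (2 * k + 3)) : Relevant k e ↔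
    (e.snd : ℕ) = e.fst + k + 1 ∨ (e.snd : ℕ) = e.fst + k + 2 := by
  have h1 : (e.fst : ℕ) < e.snd := e.2
  have h2 := e.snd.2
  unfold Relevant Edge.length
  omega

theorem relevant_relEdge (k i : ℕ) : Relevant k (relEdge k i) := by
  rw [relevant_iff]
  have := relEdge_cases k i
  omega

theorem edge_ext {n : ℕ} {e f : Edge n} (h1 : (e.fst : ℕ) = f.fst) (h2 : (e.snd : ℕ) = f.snd) :
    e = f :=
  Subtype.ext (Prod.ext (Fin.ext h1) (Fin.ext h2))

theorem relEdge_congr {i j : ℕ} (h : i % (2 * k + 3) = j % (2 * k + 3)) :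
    relEdge k i = relEdge k j := by
  have h1 := relEdge_cases k i
  have h2 := relEdge_cases k j
  exact edge_ext (by omega) (by omega)

theorem relEdge_periodic (k : ℕ) : Function.Periodic (relEdge k) (2 * k + 3) :=
  fun _ => relEdge_congr (Nat.add_mod_right _ _)

theorem mod_eq_of_relEdge_eq {i j : ℕ} (h : relEdge k i = relEdge k j) :
    i % (2 * k + 3) = j % (2 * k + 3) := by
  have h1 := relEdge_cases k i
  have h2 := relEdge_cases k j
  rw [h] at h1
  omega

theorem exists_relEdge_eq {e : Edge (2 * k + 3)} (he : Relevant k e) :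
    ∃ i < 2 * k + 3, relEdge k i = e := by
  rw [relevant_iff] at he
  have hs := e.snd.2
  rcases he with he | he
  · refine ⟨e.fst, e.fst.2, ?_⟩
    have h1 := relEdge_cases k e.fst
    rw [Nat.mod_eq_of_lt e.fst.2] at h1
    exact edge_ext (by omega) (by omega)
  · refine ⟨e.snd, e.snd.2, ?_⟩
    have h1 := relEdge_cases k e.snd
    rw [Nat.mod_eq_of_lt e.snd.2] at h1
    exact edge_ext (by omega) (by omega)

theorem relEdge_ne {i m : ℕ} (h1 : 0 < m) (h2 : m < 2 * k + 3) :
    relEdge k i ≠ relEdge k (i + m) := by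
  intro h
  have := mod_eq_of_relEdge_eq h
  have := add_mod_cases (n := 2 * k + 3) i m h2.le (by omega)
  omega

theorem cross_relEdge {i m : ℕ} (h1 : 0 < m) (h2 : m ≤ k) :
    Cross (relEdge k i) (relEdge k (i + m)) := by
  have a1 := relEdge_cases k i
  have a2 := relEdge_cases k (i + m)
  have a3 := add_mod_cases (n := 2 * k + 3) i m (by omega) (by omega)
  simp only [Cross, Fin.lt_def]
  omega

/-- The two edges share the vertex `i + k + 1`. -/
theorem not_cross_relEdge {i : ℕ} : ¬ Cross (relEdge k i) (relEdge k (i + (k + 1))) := by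
  have a1 := relEdge_cases k i
  have a2 := relEdge_cases k (i + (k + 1))
  have a3 := add_mod_cases (n := 2 * k + 3) i (k + 1) (by omega) (by omega)
  simp only [Cross, Fin.lt_def]
  omega

theorem cross_symm {n : ℕ} {e f : Edge n} (h : Cross e f) : Cross f e := Or.symm h

/-! ### Crossings as windows of consecutive relevant edges -/

/-- Edges of a `(k+1)`-crossing are relevant. -/
theorem IsCrossing.relevant {C : Finset (Edge (2 * k + 3))} (hC : IsCrossing (k + 1) C)
    {e : Edge (2 * k + 3)} (he : e ∈ C) : Relevant k e := by
  obtain ⟨hcard, hcross⟩ := hC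
  have hlt : (e.fst : ℕ) < e.snd := e.2
  have hs := e.snd.2
  have hcard' : (C.erase e).card = k := by rw [Finset.card_erase_of_mem he, hcard]; omega
  -- Each of the other `k` edges has one endpoint strictly on each side of `e`, and crossing edges
  -- share no endpoint. So each side of `e` has at least `k` vertices, which forces length at least
  -- `k + 1`.
  let inner : Edge (2 * k + 3) → Fin (2 * k + 3) := fun f =>
    if e.fst < f.fst ∧ f.fst < e.snd then f.fst else f.snd
  let outer : Edge (2 * k + 3) → Fin (2 * k + 3) := fun f =>
    if e.fst < f.fst ∧ f.fst < e.snd then f.snd else f.fst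
  have hin : (C.erase e).card ≤ (Finset.Ioo e.fst e.snd).card := by
    refine Finset.card_le_card_of_injOn inner ?_ ?_
    · intro f hf
      obtain ⟨hfe, hfC⟩ := Finset.mem_erase.1 (Finset.mem_coe.1 hf)
      have := hcross e he f hfC hfe.symm
      simp only [Cross, Fin.lt_def] at this
      simp only [inner, Finset.coe_Ioo, Set.mem_Ioo, Fin.lt_def]
      split_ifs <;> omega
    · intro f hf g hg hfg
      obtain ⟨hfe, hfC⟩ := Finset.mem_erase.1 (Finset.mem_coe.1 hf)
      obtain ⟨hge, hgC⟩ := Finset.mem_erase.1 (Finset.mem_coe.1 hg)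
      by_contra hne
      have := hcross f hfC g hgC hne
      have hf2 : (f.fst : ℕ) < f.snd := f.2
      have hg2 : (g.fst : ℕ) < g.snd := g.2
      have hv := congrArg Fin.val hfg
      simp only [Cross, Fin.lt_def] at this
      simp only [inner, Fin.lt_def] at hv
      split_ifs at hv <;> omega
  have hout : (C.erase e).card ≤ ((Finset.Icc e.fst e.snd)ᶜ).card := by
    refine Finset.card_le_card_of_injOn outer ?_ ?_
    · intro f hf
      obtain ⟨hfe, hfC⟩ := Finset.mem_erase.1 (Finset.mem_coe.1 hf)
      have := hcross e he f hfC hfe.symm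
      simp only [Cross, Fin.lt_def] at this
      simp only [outer, Finset.coe_compl, Finset.coe_Icc, Set.mem_compl_iff, Set.mem_Icc,
        Fin.lt_def, Fin.le_def]
      split_ifs <;> omega
    · intro f hf g hg hfg
      obtain ⟨hfe, hfC⟩ := Finset.mem_erase.1 (Finset.mem_coe.1 hf)
      obtain ⟨hge, hgC⟩ := Finset.mem_erase.1 (Finset.mem_coe.1 hg)
      by_contra hne
      have := hcross f hfC g hgC hne
      have hf2 : (f.fst : ℕ) < f.snd := f.2
      have hg2 : (g.fst : ℕ) < g.snd := g.2
      have hv := congrArg Fin.val hfg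
      simp only [Cross, Fin.lt_def] at this
      simp only [outer, Fin.lt_def] at hv
      split_ifs at hv <;> omega
  rw [hcard', Fin.card_Ioo] at hin
  rw [hcard', Finset.card_compl, Fintype.card_fin, Fin.card_Icc] at hout
  rw [relevant_iff]
  omega

/-- Every `(k+1)`-crossing of the `(2k+3)`-gon consists of cyclically consecutive relevant edges. -/
theorem IsCrossing.exists_window {C : Finset (Edge (2 * k + 3))} (hC : IsCrossing (k + 1) C) :
    ∃ j, ∀ m ≤ k, relEdge k (j + m) ∈ C := by
  classical
  let n := 2 * k + 3
  have hn : 0 < n := by omega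
  let P : ℕ → Prop := fun i => relEdge k i ∈ C
  have hP : ∀ i j, i % n = j % n → P i → P j := fun i j h hi => by
    change relEdge k j ∈ C
    rw [← relEdge_congr h]; exact hi
  have hN : ∀ i, P i → ¬ P (i + (k + 1)) := fun i h1 h2 =>
    not_cross_relEdge (hC.2 _ h1 _ h2 (relEdge_ne (by omega) (by omega)))
  let I := (Finset.range n).filter P
  have hI : I.card = k + 1 := by
    rw [← hC.1]
    refine Finset.card_bij (fun i _ => relEdge k i) (fun i hi => (Finset.mem_filter.1 hi).2) ?_ ?_
    · intro i hi j hj hij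
      have := mod_eq_of_relEdge_eq hij
      rwa [Nat.mod_eq_of_lt (Finset.mem_range.1 (Finset.mem_filter.1 hi).1),
        Nat.mod_eq_of_lt (Finset.mem_range.1 (Finset.mem_filter.1 hj).1)] at this
    · intro e he
      obtain ⟨i, hi, rfl⟩ := exists_relEdge_eq (hC.relevant he)
      exact ⟨i, Finset.mem_filter.2 ⟨Finset.mem_range.2 hi, he⟩, rfl⟩
  -- Edges `i` and `i + k + 1` do not cross, so `I` is disjoint from its shift `J`; together they
  -- fill all residues but one, `x`. Away from `x`, an index outside `I` lies in `J`, so moving back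
  -- by `k + 1`, that is ahead by `k + 2`, lands in `I`. Alternating these two rules shows that `I`
  -- contains `x + 1, …, x + k + 1`.
  let J := I.image fun i => (i + (k + 1)) % n
  have hJ : J.card = k + 1 := by
    rw [← hI]
    refine Finset.card_image_of_injOn fun i hi j hj hij => ?_
    have hi := Finset.mem_range.1 (Finset.mem_filter.1 (Finset.mem_coe.1 hi)).1
    have hj := Finset.mem_range.1 (Finset.mem_filter.1 (Finset.mem_coe.1 hj)).1
    have h1 := add_mod_cases (n := n) i (k + 1) (by omega) hn
    have h2 := add_mod_cases (n := n) j (k + 1) (by omega) hn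
    rw [Nat.mod_eq_of_lt hi] at h1
    rw [Nat.mod_eq_of_lt hj] at h2
    omega
  have hdisj : Disjoint I J := by
    rw [Finset.disjoint_left]
    intro i hi hiJ
    obtain ⟨j, hj, rfl⟩ := Finset.mem_image.1 hiJ
    exact hN j (Finset.mem_filter.1 hj).2
      (hP _ _ (Nat.mod_mod _ _) (Finset.mem_filter.1 hi).2)
  have hIJ : I ∪ J ⊆ Finset.range n := by
    refine Finset.union_subset (Finset.filter_subset _ _) fun i hi => ?_
    obtain ⟨j, -, rfl⟩ := Finset.mem_image.1 hi
    exact Finset.mem_range.2 (Nat.mod_lt _ hn)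
  have hcard : (I ∪ J).card = 2 * k + 2 := by
    rw [Finset.card_union_of_disjoint hdisj, hI, hJ]; omega
  obtain ⟨x, hx⟩ : ∃ x, Finset.range n \ (I ∪ J) = {x} := by
    rw [← Finset.card_eq_one, Finset.card_sdiff_of_subset hIJ, hcard, Finset.card_range]
    omega
  have hx' : x ∈ Finset.range n \ (I ∪ J) := hx ▸ Finset.mem_singleton_self x
  rw [Finset.mem_sdiff, Finset.mem_union, not_or] at hx'
  have hxn := Finset.mem_range.1 hx'.1
  have hU : ∀ y, y % n ≠ x → ¬ P y → P (y + (k + 2)) := by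
    intro y hy hPy
    have hmem : y % n ∈ I ∪ J := by
      by_contra hmem
      have : y % n ∈ Finset.range n \ (I ∪ J) :=
        Finset.mem_sdiff.2 ⟨Finset.mem_range.2 (Nat.mod_lt _ hn), hmem⟩
      rw [hx] at this
      exact hy (Finset.mem_singleton.1 this)
    rcases Finset.mem_union.1 hmem with h | h
    · exact absurd (hP _ _ (Nat.mod_mod _ _) (Finset.mem_filter.1 h).2) hPy
    · obtain ⟨j, hj, hjy⟩ := Finset.mem_image.1 h
      refine hP j _ ?_ (Finset.mem_filter.1 hj).2
      rw [Nat.add_mod y, ← hjy, ← Nat.add_mod, show j + (k + 1) + (k + 2) = j + n by omega,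
        Nat.add_mod_right]
  refine ⟨x + 1, ?_⟩
  intro m
  induction m with
  | zero =>
    intro _
    have h0 : ¬ P (x + (k + 2)) := by
      intro h
      refine hx'.2.2 (Finset.mem_image.2 ⟨(x + (k + 2)) % n, Finset.mem_filter.2
        ⟨Finset.mem_range.2 (Nat.mod_lt _ hn), hP _ _ (Nat.mod_mod _ _).symm h⟩, ?_⟩)
      rw [Nat.mod_add_mod, show x + (k + 2) + (k + 1) = x + n by omega, Nat.add_mod_right,
        Nat.mod_eq_of_lt hxn]
    have h1 := add_mod_cases (n := n) x (k + 2) (by omega) hn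
    rw [Nat.mod_eq_of_lt hxn] at h1
    refine hP _ _ ?_ (hU _ (by omega) h0)
    rw [show x + (k + 2) + (k + 2) = x + 1 + 0 + n by omega, Nat.add_mod_right]
  | succ m ih =>
    intro hm
    have h0 : ¬ P (x + (k + 3 + m)) := by
      intro h
      refine hN _ h (hP _ _ ?_ (ih (by omega)))
      rw [show x + (k + 3 + m) + (k + 1) = x + 1 + m + n by omega, Nat.add_mod_right]
    have h1 := add_mod_cases (n := n) x (k + 3 + m) (by omega) hn
    rw [Nat.mod_eq_of_lt hxn] at h1
    refine hP _ _ ?_ (hU _ (by omega) h0)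
    rw [show x + (k + 3 + m) + (k + 2) = x + 1 + (m + 1) + n by omega, Nat.add_mod_right]

theorem isCrossing_window (k j : ℕ) :
    IsCrossing (k + 1) ((Finset.range (k + 1)).image fun m => relEdge k (j + m)) := by
  have hne : ∀ m m', m < m' → m' ≤ k → Cross (relEdge k (j + m)) (relEdge k (j + m')) := by
    intro m m' h h'
    have := cross_relEdge (k := k) (i := j + m) (m := m' - m) (by omega) (by omega)
    rwa [show j + m + (m' - m) = j + m' by omega] at this
  constructor
  · rw [Finset.card_image_of_injOn, Finset.card_range]
    intro m hm m' hm' h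
    have hm := Finset.mem_range.1 (Finset.mem_coe.1 hm)
    have hm' := Finset.mem_range.1 (Finset.mem_coe.1 hm')
    by_contra hmm
    rcases lt_or_gt_of_ne hmm with hlt | hlt
    · refine relEdge_ne (k := k) (i := j + m) (m := m' - m) (by omega) (by omega) ?_
      rw [show j + m + (m' - m) = j + m' by omega]; exact h
    · refine relEdge_ne (k := k) (i := j + m') (m := m - m') (by omega) (by omega) ?_
      rw [show j + m' + (m - m') = j + m by omega]; exact h.symm
  · intro e he f hf hef
    obtain ⟨m, hm, rfl⟩ := Finset.mem_image.1 he
    obtain ⟨m', hm', rfl⟩ := Finset.mem_image.1 hf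
    have hm := Finset.mem_range.1 hm
    have hm' := Finset.mem_range.1 hm'
    rcases lt_trichotomy m m' with hlt | rfl | hlt
    · exact hne _ _ hlt (by omega)
    · exact absurd rfl hef
    · exact cross_symm (hne _ _ hlt (by omega))

/-! ### Faces and triples with short steps -/

/-- `a`, `a + s`, `a + s + r` split the cycle of length `2k + 3` into steps of size at most
`k + 1`. -/
def ShortSteps (k s r : ℕ) : Prop :=
  1 ≤ s ∧ s ≤ k + 1 ∧ 1 ≤ r ∧ r ≤ k + 1 ∧ k + 2 ≤ s + r

/-- Greedy choice: from `a`, jump to the farthest index of `P` within `k + 1`, then to one within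
the next `k + 1`. Maximality of the first jump gives `s + r ≥ k + 2`, which says that the way back
to `a` is short as well. -/
theorem exists_shortSteps {P : ℕ → Prop} (hP : ∀ j, ∃ m ≤ k, P (j + m)) :
    ∃ a s r, ShortSteps k s r ∧ P a ∧ P (a + s) ∧ P (a + s + r) := by
  classical
  obtain ⟨a, -, ha⟩ := hP 0
  rw [zero_add] at ha
  obtain ⟨m, hm, hPm⟩ := hP (a + 1)
  let s := Nat.findGreatest (fun s => P (a + s)) (k + 1)
  have hm1 : m + 1 ≤ k + 1 := by omega
  have hPm' : P (a + (m + 1)) := by rwa [show a + (m + 1) = a + 1 + m by omega]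
  have hs : P (a + s) := Nat.findGreatest_spec (P := fun s => P (a + s)) hm1 hPm'
  have hs1 : m + 1 ≤ s := Nat.le_findGreatest hm1 hPm'
  have hs2 : s ≤ k + 1 := Nat.findGreatest_le _
  obtain ⟨r, hr, hPr⟩ := hP (a + s + 1)
  rw [show a + s + 1 + r = a + s + (r + 1) by omega] at hPr
  refine ⟨a, s, r + 1, ⟨by omega, hs2, by omega, by omega, ?_⟩, ha, hs, hPr⟩
  by_contra hlt
  have : s + (r + 1) ≤ s := Nat.le_findGreatest (P := fun s => P (a + s)) (by omega)
    (by rwa [← add_assoc])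
  omega

/-- Cyclic gaps of at most `k + 1` leave no room for `k + 1` consecutive indices without one of the
three. The case split finds the first of them met from `j` onwards. -/
theorem ShortSteps.exists_mem_window {P : ℕ → Prop} (hP : Function.Periodic P (2 * k + 3))
    {a s r : ℕ} (h : ShortSteps k s r) (ha : P a) (hs : P (a + s)) (hr : P (a + s + r)) (j : ℕ) :
    ∃ m ≤ k, P (j + m) := by
  obtain ⟨h1, h2, h3, h4, h5⟩ := h
  obtain ⟨i, hi, hia⟩ := exists_modEq_add (n := 2 * k + 3) (by omega) a j
  have hcongr : ∀ x y, x % (2 * k + 3) = y % (2 * k + 3) → P x → P y := by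
    intro x y hxy hx
    rw [← hP.map_mod_nat] at hx ⊢
    rwa [← hxy]
  have hshift : ∀ t, (a + t) % (2 * k + 3) = (j + i + t) % (2 * k + 3) := by
    intro t
    rw [Nat.add_mod, ← hia, ← Nat.add_mod]
  by_cases c1 : i ≤ k
  · exact ⟨i, c1, hcongr _ _ hia.symm ha⟩
  by_cases c2 : 2 * k + 3 ≤ i + s
  · refine ⟨i + s - (2 * k + 3), by omega, hcongr _ _ ?_ hs⟩
    rw [hshift, show j + i + s = j + (i + s - (2 * k + 3)) + (2 * k + 3) by omega,
      Nat.add_mod_right]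
  · refine ⟨i + s + r - (2 * k + 3), by omega, hcongr _ _ ?_ hr⟩
    rw [add_assoc, hshift, show j + i + (s + r) = j + (i + s + r - (2 * k + 3)) + (2 * k + 3)
      by omega, Nat.add_mod_right]

/-- Windows are crossings, so the complement of `F` meets every window. Together with
`ShortSteps.crossingFree`, this describes the crossing-free sets as those that miss a triple with
short steps. -/
theorem CrossingFree.exists_shortSteps {F : Finset (Edge (2 * k + 3))}
    (hF : CrossingFree (k + 1) F) : ∃ a s r, ShortSteps k s r ∧ relEdge k a ∉ F ∧
      relEdge k (a + s) ∉ F ∧ relEdge k (a + s + r) ∉ F := by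
  refine Multiassociahedron.exists_shortSteps (P := fun i => relEdge k i ∉ F) fun j => ?_
  by_contra! h
  refine hF _ (fun e he => ?_) (isCrossing_window k j)
  obtain ⟨m, hm, rfl⟩ := Finset.mem_image.1 he
  exact h m (by have := Finset.mem_range.1 hm; omega)

theorem ShortSteps.crossingFree {F : Finset (Edge (2 * k + 3))} {a s r : ℕ}
    (h : ShortSteps k s r) (ha : relEdge k a ∉ F) (hs : relEdge k (a + s) ∉ F)
    (hr : relEdge k (a + s + r) ∉ F) : CrossingFree (k + 1) F := by
  intro C hCF hC
  obtain ⟨j, hj⟩ := hC.exists_window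
  obtain ⟨m, hm, hmF⟩ := h.exists_mem_window (P := fun i => relEdge k i ∉ F)
    (fun i => by simp only [relEdge_periodic k i]) ha hs hr j
  exact hmF (hCF (hj m hm))

theorem ShortSteps.relEdge_ne (a : ℕ) {s r : ℕ} (h : ShortSteps k s r) :
    relEdge k a ≠ relEdge k (a + s) ∧ relEdge k a ≠ relEdge k (a + s + r) ∧
      relEdge k (a + s) ≠ relEdge k (a + s + r) := by
  obtain ⟨h1, h2, h3, h4, h5⟩ := h
  refine ⟨Multiassociahedron.relEdge_ne (by omega) (by omega), ?_,
    Multiassociahedron.relEdge_ne (by omega) (by omega)⟩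
  rw [add_assoc]
  by_cases hn : s + r < 2 * k + 3
  · exact Multiassociahedron.relEdge_ne (by omega) hn
  · omega

theorem ShortSteps.card_triple (a : ℕ) {s r : ℕ} (h : ShortSteps k s r) :
    ({relEdge k a, relEdge k (a + s), relEdge k (a + s + r)} :
      Finset (Edge (2 * k + 3))).card = 3 := by
  obtain ⟨h1, h2, h3⟩ := h.relEdge_ne a
  exact Finset.card_eq_three.2 ⟨_, _, _, h1, h2, h3, rfl⟩

theorem disjoint_endpoints_relEdge {i m : ℕ} (h0 : 0 < m) (h1 : m < 2 * k + 3) (h2 : m ≠ k + 1)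
    (h3 : m ≠ k + 2) :
    Disjoint (relEdge k i).endpoints (relEdge k (i + m)).endpoints := by
  have a1 := relEdge_cases k i
  have a2 := relEdge_cases k (i + m)
  have a3 := add_mod_cases (n := 2 * k + 3) i m (by omega) (by omega)
  simp only [Edge.endpoints, Finset.disjoint_insert_left, Finset.disjoint_singleton_left,
    Finset.mem_insert, Finset.mem_singleton, Fin.ext_iff]
  omega

/-- The complement of three relevant edges with short steps and no common endpoints is an octahedral
triangulation. -/
theorem ShortSteps.isOctahedral (a : ℕ) {s r : ℕ} (h : ShortSteps k s r) (hs : s ≤ k) (hr : r ≤ k)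
    (hsr : k + 3 ≤ s + r) :
    IsOctahedral k ({relEdge k a, relEdge k (a + s), relEdge k (a + s + r)}ᶜ) := by
  have h1 := h
  obtain ⟨g1, g2, g3, g4, g5⟩ := h1
  have d1 := disjoint_endpoints_relEdge (k := k) (i := a) (m := s) (by omega) (by omega) (by omega)
    (by omega)
  have d2 := disjoint_endpoints_relEdge (k := k) (i := a) (m := s + r) (by omega) (by omega)
    (by omega) (by omega)
  have d3 := disjoint_endpoints_relEdge (k := k) (i := a + s) (m := r) (by omega) (by omega)
    (by omega) (by omega)
  rw [← add_assoc] at d2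
  refine ⟨⟨?_, ?_⟩, ?_, ?_⟩
  · exact h.crossingFree (a := a) (by simp) (by simp) (by simp)
  -- A larger crossing-free set still misses some triple with short steps; this triple lies among
  -- the three edges missing here, hence equals them.
  · intro T' hT' hle
    obtain ⟨a', s', r', h', ha', hs', hr'⟩ := CrossingFree.exists_shortSteps hT'
    have hsub : ({relEdge k a', relEdge k (a' + s'), relEdge k (a' + s' + r')} :
        Finset (Edge (2 * k + 3))) ⊆ T'ᶜ := by
      intro e he
      simp only [Finset.mem_insert, Finset.mem_singleton] at he
      rw [Finset.mem_compl]
      rcases he with rfl | rfl | rfl <;> assumption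
    have hsub2 : T'ᶜ ⊆ {relEdge k a, relEdge k (a + s), relEdge k (a + s + r)} :=
      compl_le_iff_compl_le.1 hle
    have := Finset.eq_of_subset_of_card_le (hsub.trans hsub2)
      (by rw [h.card_triple, h'.card_triple])
    rw [← this]
    exact le_compl_iff_le_compl.1 hsub
  · rw [compl_compl, h.card_triple]
  · rw [compl_compl]
    intro e he f hf hef
    simp only [Finset.mem_insert, Finset.mem_singleton] at he hf
    rcases he with rfl | rfl | rfl <;> rcases hf with rfl | rfl | rfl <;>
      first
      | exact absurd rfl hef
      | assumption
      | exact d1.symm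
      | exact d2.symm
      | exact d3.symm

/-- A non-relevant edge lies in no `(k+1)`-crossing, so it can be added freely, and maximality
forces it into `T`. -/
theorem IsTriangulation.relevant_of_notMem {T : Finset (Edge (2 * k + 3))}
    (hT : IsTriangulation k T) {e : Edge (2 * k + 3)} (he : e ∉ T) : Relevant k e := by
  by_contra hrel
  have hfree : CrossingFree (k + 1) (insert e T) := by
    intro C hCT hC
    refine hT.prop C (fun f hf => ?_) hC
    rcases Finset.mem_insert.1 (hCT hf) with rfl | h
    · exact absurd (hC.relevant hf) hrel
    · exact h
  exact he (hT.le_of_ge hfree (Finset.subset_insert e T) (Finset.mem_insert_self e T))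

end Combinatorics

end Multiassociahedron
namespace Multiassociahedron

/-! ### Half-planes of the relevant edges -/

section Geometry

variable {k : ℕ}

/-- The points `q` are in convex position, with orientation `σ`. -/
def OrientedConvex {n : ℕ} (σ : ℝ) (q : Fin n → ℝ × ℝ) : Prop :=
  (σ = 1 ∨ σ = -1) ∧ ∀ a b c : Fin n, a < b → b < c → 0 < σ * orient (q a) (q b) (q c)

theorem ConvexPosition.exists_oriented {n : ℕ} {q : Fin n → ℝ × ℝ} (hq : ConvexPosition q) :
    ∃ σ, OrientedConvex σ q := by
  rcases hq with h | h
  · exact ⟨1, Or.inl rfl, fun a b c h1 h2 => by rw [one_mul]; exact h a b c h1 h2⟩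
  · exact ⟨-1, Or.inr rfl, fun a b c h1 h2 => by have := h a b c h1 h2; linarith⟩

theorem OrientedConvex.orient_ne_zero {n : ℕ} {σ : ℝ} {q : Fin n → ℝ × ℝ}
    (hq : OrientedConvex σ q) (i j l : Fin n) (hij : i ≠ j) (hil : i ≠ l) (hjl : j ≠ l) :
    orient (q i) (q j) (q l) ≠ 0 := by
  have key : ∀ a b c, a < b → b < c → orient (q a) (q b) (q c) ≠ 0 := fun a b c h1 h2 h => by
    have := hq.2 a b c h1 h2
    rw [h, mul_zero] at this
    exact lt_irrefl _ this
  have s1 : ∀ a b c : ℝ × ℝ, orient a b c = orient b c a := by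
    intros; simp only [orient]; ring
  have s2 : ∀ a b c : ℝ × ℝ, orient a b c = - orient b a c := by
    intros; simp only [orient]; ring
  rcases lt_or_gt_of_ne hij with h1 | h1 <;> rcases lt_or_gt_of_ne hil with h2 | h2 <;>
    rcases lt_or_gt_of_ne hjl with h3 | h3
  · exact key _ _ _ h1 h3
  · rw [s1, s2, s1, s1, neg_ne_zero]; exact key _ _ _ h2 h3
  · exact absurd (h3.trans h2) h1.not_gt
  · rw [s1, s1]; exact key _ _ _ h2 h1
  · rw [s2, neg_ne_zero]; exact key _ _ _ h1 h2
  · exact absurd (h2.trans h3) h1.not_gt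
  · rw [s1]; exact key _ _ _ h3 h2
  · rw [s2, s1, s1, neg_ne_zero]; exact key _ _ _ h3 h1

/-- The configuration as a periodic sequence. -/
def cyc (q : Fin (2 * k + 3) → ℝ × ℝ) (i : ℕ) : ℝ × ℝ :=
  q ⟨i % (2 * k + 3), Nat.mod_lt _ (by omega)⟩

theorem cyc_congr (q : Fin (2 * k + 3) → ℝ × ℝ) {i j : ℕ}
    (h : i % (2 * k + 3) = j % (2 * k + 3)) : cyc q i = cyc q j := by
  unfold cyc; simp only [h]

theorem cyc_periodic (q : Fin (2 * k + 3) → ℝ × ℝ) : Function.Periodic (cyc q) (2 * k + 3) :=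
  fun _ => cyc_congr q (Nat.add_mod_right _ _)

theorem cyc_eq (q : Fin (2 * k + 3) → ℝ × ℝ) {i : ℕ} {v : Fin (2 * k + 3)}
    (h : i % (2 * k + 3) = v) : cyc q i = q v := by
  unfold cyc; congr 1; exact Fin.ext h

variable {σ : ℝ} {q : Fin (2 * k + 3) → ℝ × ℝ}

theorem OrientedConvex.orient_cyc_pos (hq : OrientedConvex σ q) (i : ℕ) {m m' : ℕ} (h0 : 0 < m)
    (h1 : m < m') (h2 : m' < 2 * k + 3) :
    0 < σ * orient (cyc q i) (cyc q (i + m)) (cyc q (i + m')) := by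
  have hi := Nat.mod_lt i (show 0 < 2 * k + 3 by omega)
  have c1 := add_mod_cases (n := 2 * k + 3) i m (by omega) (by omega)
  have c2 := add_mod_cases (n := 2 * k + 3) i m' (by omega) (by omega)
  have s1 : ∀ a b c : ℝ × ℝ, orient a b c = orient b c a := by
    intros; simp only [orient]; ring
  rcases c1 with c1 | c1 <;> rcases c2 with c2 | c2
  · exact hq.2 _ _ _ (by rw [Fin.mk_lt_mk]; omega) (by rw [Fin.mk_lt_mk]; omega)
  · rw [s1, s1]
    exact hq.2 _ _ _ (by rw [Fin.mk_lt_mk]; omega) (by rw [Fin.mk_lt_mk]; omega)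
  · omega
  · rw [s1]
    exact hq.2 _ _ _ (by rw [Fin.mk_lt_mk]; omega) (by rw [Fin.mk_lt_mk]; omega)

/-- The linear form whose positive side, at height one, is the big half-plane of the relevant edge
with index `i`. -/
def bigForm (σ : ℝ) (q : Fin (2 * k + 3) → ℝ × ℝ) (i : ℕ) : ℝ × ℝ × ℝ →ₗ[ℝ] ℝ :=
  σ • lineForm (cyc q i) (cyc q (i + (k + 1)))

theorem bigForm_apply (i : ℕ) (p : ℝ × ℝ × ℝ) :
    bigForm σ q i p = σ * lineForm (cyc q i) (cyc q (i + (k + 1))) p := rfl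

theorem bigForm_congr {i j : ℕ} (h : i % (2 * k + 3) = j % (2 * k + 3)) :
    bigForm σ q i = bigForm σ q j := by
  unfold bigForm
  rw [cyc_congr q h, cyc_congr q (show (i + (k + 1)) % (2 * k + 3) = (j + (k + 1)) % (2 * k + 3) by
    rw [Nat.add_mod, h, ← Nat.add_mod])]

/-- A vertex in homogeneous coordinates. -/
def vtx (q : Fin (2 * k + 3) → ℝ × ℝ) (i : ℕ) : ℝ × ℝ × ℝ := ((cyc q i).1, (cyc q i).2, 1)

theorem vtx_add_period (i : ℕ) : vtx q (i + (2 * k + 3)) = vtx q i := by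
  unfold vtx; rw [cyc_periodic q]

theorem bigForm_vtx (i j : ℕ) : bigForm σ q i (vtx q j) =
    σ * orient (cyc q i) (cyc q (i + (k + 1))) (cyc q j) := by
  rw [bigForm_apply, vtx, lineForm_point]

theorem bigForm_vtx_self (i : ℕ) : bigForm σ q i (vtx q i) = 0 := by
  rw [bigForm_vtx]; simp only [orient]; ring

theorem bigForm_vtx_succ (i : ℕ) : bigForm σ q i (vtx q (i + (k + 1))) = 0 := by
  rw [bigForm_vtx]; simp only [orient]; ring

theorem OrientedConvex.bigForm_vtx_pos (hq : OrientedConvex σ q) (i : ℕ) {m : ℕ} (h1 : k + 2 ≤ m)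
    (h2 : m ≤ 2 * k + 2) : 0 < bigForm σ q i (vtx q (i + m)) := by
  rw [bigForm_vtx]
  exact hq.orient_cyc_pos i (by omega) (by omega) (by omega)

theorem OrientedConvex.bigForm_vtx_nonpos (hq : OrientedConvex σ q) (i : ℕ) {m : ℕ}
    (h : m ≤ k + 1) : bigForm σ q i (vtx q (i + m)) ≤ 0 := by
  rcases Nat.eq_zero_or_pos m with rfl | hm
  · exact (bigForm_vtx_self i).le
  rcases h.eq_or_lt with rfl | hlt
  · exact (bigForm_vtx_succ i).le
  · have := hq.orient_cyc_pos i hm hlt (by omega)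
    rw [bigForm_vtx]
    have h' : orient (cyc q i) (cyc q (i + (k + 1))) (cyc q (i + m))
      = - orient (cyc q i) (cyc q (i + m)) (cyc q (i + (k + 1))) := by
      simp only [orient]; ring
    rw [h']; linarith

/-- The direction of the relevant edge with index `i`. -/
def dir (q : Fin (2 * k + 3) → ℝ × ℝ) (i : ℕ) : ℝ × ℝ := cyc q (i + (k + 1)) - cyc q i

/-- The edge `i + m` starts on the closed small side of the edge `i` and ends strictly on its big
side. Hence the directions of a triple with short steps turn around in one sense, by less than a
half-turn each time. -/
theorem OrientedConvex.det2_dir_pos (hq : OrientedConvex σ q) (i : ℕ) {m : ℕ} (h1 : 1 ≤ m)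
    (h2 : m ≤ k + 1) : 0 < σ * det2 (dir q i) (dir q (i + m)) := by
  have h3 := hq.bigForm_vtx_pos i (m := m + (k + 1)) (by omega) (by omega)
  have h4 := hq.bigForm_vtx_nonpos i h2
  rw [bigForm_vtx, ← add_assoc i m] at h3
  rw [bigForm_vtx] at h4
  have : det2 (dir q i) (dir q (i + m)) =
      orient (cyc q i) (cyc q (i + (k + 1))) (cyc q (i + m + (k + 1))) -
      orient (cyc q i) (cyc q (i + (k + 1))) (cyc q (i + m)) := by
    simp only [det2, dir, orient, Prod.fst_sub, Prod.snd_sub]; ring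
  rw [this]; linarith

/-- The relation `det(v, w) u + det(w, u) v + det(u, v) w = 0` between plane vectors cancels the
dependence on the first two coordinates, so only a multiple of the height remains. -/
theorem bigForm_combination (a b c : ℕ) (p : ℝ × ℝ × ℝ) :
    det2 (dir q b) (dir q c) * bigForm σ q a p + det2 (dir q c) (dir q a) * bigForm σ q b p
      + det2 (dir q a) (dir q b) * bigForm σ q c p =
    (det2 (dir q b) (dir q c) * bigForm σ q a (0, 0, 1) +
      det2 (dir q c) (dir q a) * bigForm σ q b (0, 0, 1)
      + det2 (dir q a) (dir q b) * bigForm σ q c (0, 0, 1)) * p.2.2 := by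
  simp only [bigForm_apply, lineForm_apply, det2, dir, Prod.fst_sub, Prod.snd_sub]; ring

/-- If some point lies in all big half-planes then the height is a positive combination of the
forms of any three relevant edges with short steps, and these forms are linearly independent. -/
theorem OrientedConvex.height_eq_combination (hq : OrientedConvex σ q) {p₀ : ℝ × ℝ × ℝ}
    (hp₀ : ∀ i, 0 < bigForm σ q i p₀) (hp₀' : p₀.2.2 = 1) (a : ℕ) {s r : ℕ}
    (h : ShortSteps k s r) :
    (∃ la lb lc : ℝ, 0 < la ∧ 0 < lb ∧ 0 < lc ∧ ∀ p : ℝ × ℝ × ℝ, p.2.2 = la * bigForm σ q a p +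
      lb * bigForm σ q (a + s) p + lc * bigForm σ q (a + s + r) p) ∧
    ∀ p, bigForm σ q a p = 0 → bigForm σ q (a + s) p = 0 → bigForm σ q (a + s + r) p = 0 →
      p = 0 := by
  obtain ⟨h1, h2, h3, h4, h5⟩ := h
  have dab := hq.det2_dir_pos a h1 h2
  have dbc := hq.det2_dir_pos (a + s) h3 h4
  have dca := hq.det2_dir_pos (a + s + r) (m := 2 * k + 3 - (s + r)) (by omega) (by omega)
  have hdir : dir q (a + s + r + (2 * k + 3 - (s + r))) = dir q a := by
    rw [show a + s + r + (2 * k + 3 - (s + r)) = a + (2 * k + 3) by omega]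
    unfold dir
    rw [show a + (2 * k + 3) + (k + 1) = a + (k + 1) + (2 * k + 3) by ring, cyc_periodic q,
      cyc_periodic q]
  rw [hdir] at dca
  have key := bigForm_combination (σ := σ) (q := q) a (a + s) (a + s + r)
  set la := det2 (dir q (a + s)) (dir q (a + s + r))
  set lb := det2 (dir q (a + s + r)) (dir q a)
  set lc := det2 (dir q a) (dir q (a + s))
  set C := la * bigForm σ q a (0, 0, 1) + lb * bigForm σ q (a + s) (0, 0, 1)
    + lc * bigForm σ q (a + s + r) (0, 0, 1)
  -- The common point has height one and makes every term on the left of `key` positive after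
  -- multiplication by `σ`.
  have hC : 0 < σ * C := by
    have := key p₀
    rw [hp₀', mul_one] at this
    rw [← this]
    have m1 := mul_pos dbc (hp₀ a)
    have m2 := mul_pos dca (hp₀ (a + s))
    have m3 := mul_pos dab (hp₀ (a + s + r))
    linarith
  have hC' : σ * C ≠ 0 := hC.ne'
  have hcomb : ∀ p : ℝ × ℝ × ℝ, p.2.2 = σ * la / (σ * C) * bigForm σ q a p +
      σ * lb / (σ * C) * bigForm σ q (a + s) p
      + σ * lc / (σ * C) * bigForm σ q (a + s + r) p := by
    intro p
    rw [div_mul_eq_mul_div, div_mul_eq_mul_div, div_mul_eq_mul_div, ← add_div, ← add_div,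
      eq_div_iff hC']
    linear_combination (-σ) * key p
  refine ⟨⟨_, _, _, div_pos dbc hC, div_pos dca hC, div_pos dab hC, hcomb⟩, ?_⟩
  intro p pa pb pc
  have ht : p.2.2 = 0 := by rw [hcomb p, pa, pb, pc]; ring
  have hlc : lc ≠ 0 := fun h0 => by rw [h0, mul_zero] at dab; exact lt_irrefl _ dab
  have hσ : σ ≠ 0 := fun h0 => by rw [h0, zero_mul] at dab; exact lt_irrefl _ dab
  have ea : det2 (dir q a) (p.1, p.2.1) = 0 := by
    refine (mul_eq_zero.1 (?_ : σ * _ = 0)).resolve_left hσ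
    rw [← pa, bigForm_apply, lineForm_apply, ht]
    simp only [det2, dir, Prod.fst_sub, Prod.snd_sub]; ring
  have eb : det2 (dir q (a + s)) (p.1, p.2.1) = 0 := by
    refine (mul_eq_zero.1 (?_ : σ * _ = 0)).resolve_left hσ
    rw [← pb, bigForm_apply, lineForm_apply, ht]
    simp only [det2, dir, Prod.fst_sub, Prod.snd_sub]; ring
  have hx : p.1 = 0 := by
    refine (mul_eq_zero.1 (?_ : lc * p.1 = 0)).resolve_left hlc
    simp only [lc, det2] at ea eb ⊢
    linear_combination (dir q (a + s)).1 * ea - (dir q a).1 * eb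
  have hy : p.2.1 = 0 := by
    refine (mul_eq_zero.1 (?_ : lc * p.2.1 = 0)).resolve_left hlc
    simp only [lc, det2] at ea eb ⊢
    linear_combination (dir q (a + s)).2 * ea - (dir q a).2 * eb
  exact Prod.ext hx (Prod.ext hy ht)

/-- A vector on the positive side of all relevant edges has positive height. -/
theorem OrientedConvex.height_pos (hk : 1 ≤ k) (hq : OrientedConvex σ q) {p : ℝ × ℝ × ℝ}
    (hp : ∀ i, 0 < bigForm σ q i p) : 0 < p.2.2 := by
  by_contra! ht
  have h0 := hp 0
  have h1 := hp 1
  have h2 := hp (k + 2)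
  have e1 := hq.orient_cyc_pos 0 (m := 1) (m' := k + 1) (by omega) (by omega) (by omega)
  have e2 := hq.orient_cyc_pos 0 (m := 1) (m' := k + 2) (by omega) (by omega) (by omega)
  have e3 := hq.orient_cyc_pos 0 (m := k + 1) (m' := k + 2) (by omega) (by omega) (by omega)
  simp only [zero_add] at e1 e2 e3
  rw [bigForm_apply, zero_add] at h0
  rw [bigForm_apply, show 1 + (k + 1) = k + 2 by omega] at h1
  rw [bigForm_apply, show k + 2 + (k + 1) = 0 + (2 * k + 3) by omega, cyc_periodic q] at h2
  -- The side forms of the triangle `0, 1, k + 2` add up to its area times the height. With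
  -- nonpositive height, the form of the side `{0, 1}` is negative, which contradicts the three-term
  -- relation `f2` at vertex `0`.
  have f1 : σ * lineForm (cyc q 0) (cyc q 1) p =
      σ * orient (cyc q 0) (cyc q 1) (cyc q (k + 2)) * p.2.2
      - σ * lineForm (cyc q 1) (cyc q (k + 2)) p - σ * lineForm (cyc q (k + 2)) (cyc q 0) p := by
    simp only [lineForm_apply, orient]; ring
  have f2 : (σ * lineForm (cyc q 0) (cyc q 1) p) *
        (σ * orient (cyc q 0) (cyc q (k + 1)) (cyc q (k + 2)))
      - (σ * lineForm (cyc q 0) (cyc q (k + 1)) p) *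
        (σ * orient (cyc q 0) (cyc q 1) (cyc q (k + 2)))
      - (σ * lineForm (cyc q (k + 2)) (cyc q 0) p) *
        (σ * orient (cyc q 0) (cyc q 1) (cyc q (k + 1))) = 0 := by
    simp only [lineForm_apply, orient]; ring
  have g1 := mul_nonpos_of_nonneg_of_nonpos e2.le ht
  have g2 : σ * lineForm (cyc q 0) (cyc q 1) p < 0 := by linarith
  have g3 := mul_neg_of_neg_of_pos g2 e3
  have g4 := mul_pos h0 e2
  have g5 := mul_pos h2 e1
  linarith

/-- Walking from `i` to `i + k + 1` either follows the order of the endpoints or, after wrapping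
around, reverses it. The number of vertices strictly between the endpoints is `k` or `k + 1`
accordingly. -/
theorem cyc_relEdge (q : Fin (2 * k + 3) → ℝ × ℝ) (i : ℕ) :
    (((relEdge k i).snd : ℕ) = (relEdge k i).fst + k + 1 ∧ cyc q i = q (relEdge k i).fst ∧
      cyc q (i + (k + 1)) = q (relEdge k i).snd) ∨
    (((relEdge k i).snd : ℕ) = (relEdge k i).fst + k + 2 ∧ cyc q i = q (relEdge k i).snd ∧
      cyc q (i + (k + 1)) = q (relEdge k i).fst) := by
  have h := relEdge_cases k i
  have c := add_mod_cases (n := 2 * k + 3) i (k + 1) (by omega) (by omega)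
  rcases h.2 with h' | h'
  · exact Or.inl ⟨by omega, cyc_eq q (by omega), cyc_eq q (by omega)⟩
  · exact Or.inr ⟨by omega, cyc_eq q (by omega), cyc_eq q (by omega)⟩

theorem OrientedConvex.sq_eq_one {n : ℕ} {σ : ℝ} {q : Fin n → ℝ × ℝ} (hq : OrientedConvex σ q) :
    σ * σ = 1 := by
  rcases hq.1 with rfl | rfl <;> norm_num

theorem OrientedConvex.orient_edge_sign {n : ℕ} {σ : ℝ} {q : Fin n → ℝ × ℝ}
    (hq : OrientedConvex σ q) (e : Edge n) (l : Fin n) :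
    (l ∈ Finset.Ioo e.fst e.snd → σ * orient (q e.fst) (q e.snd) (q l) < 0) ∧
    (l ∉ Finset.Icc e.fst e.snd → 0 < σ * orient (q e.fst) (q e.snd) (q l)) := by
  constructor
  · intro h
    rw [Finset.mem_Ioo] at h
    have := hq.2 _ _ _ h.1 h.2
    have h' : orient (q e.fst) (q e.snd) (q l) = - orient (q e.fst) (q l) (q e.snd) := by
      simp only [orient]; ring
    rw [h']; linarith
  · intro h
    rw [Finset.mem_Icc, not_and_or, not_le, not_le] at h
    rcases h with h | h
    · have := hq.2 _ _ _ h e.2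
      have h' : orient (q e.fst) (q e.snd) (q l) = orient (q l) (q e.fst) (q e.snd) := by
        simp only [orient]; ring
      rw [h']; exact this
    · exact hq.2 _ _ _ e.2 h

/-- Of the `2k + 1` factors, those of the vertices strictly between the endpoints have sign `-σ` and
the others sign `σ`; an odd number of factors leaves a single `σ`. -/
theorem OrientedConvex.prod_orient_sign (hq : OrientedConvex σ q) (e : Edge (2 * k + 3)) :
    0 < σ * (-1) ^ ((e.snd : ℕ) - e.fst - 1) *
      ∏ l ∈ (Finset.univ.erase e.fst).erase e.snd, orient (q e.fst) (q e.snd) (q l) := by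
  have hpos : 0 < ∏ l ∈ (Finset.univ.erase e.fst).erase e.snd,
      (σ * (if l ∈ Finset.Ioo e.fst e.snd then -1 else 1)) *
        orient (q e.fst) (q e.snd) (q l) := by
    refine Finset.prod_pos fun l hl => ?_
    have h1 := Finset.ne_of_mem_erase hl
    have h2 := Finset.ne_of_mem_erase (Finset.mem_of_mem_erase hl)
    split_ifs with h
    · have := (hq.orient_edge_sign e l).1 h
      linarith
    · rw [mul_one]
      refine (hq.orient_edge_sign e l).2 fun h' => h ?_
      rw [Finset.mem_Icc] at h'
      exact Finset.mem_Ioo.2 ⟨lt_of_le_of_ne h'.1 h2.symm, lt_of_le_of_ne h'.2 h1⟩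
  have hfilter : ((Finset.univ.erase e.fst).erase e.snd).filter
      (fun l => l ∈ Finset.Ioo e.fst e.snd) = Finset.Ioo e.fst e.snd := by
    ext l
    simp only [Finset.mem_filter, Finset.mem_erase, Finset.mem_univ, Finset.mem_Ioo, and_true,
      and_iff_right_iff_imp]
    exact fun h => ⟨h.2.ne, h.1.ne'⟩
  rw [Finset.prod_mul_distrib, Finset.prod_mul_distrib, Finset.prod_const, Finset.prod_ite,
    Finset.prod_const_one, mul_one, Finset.prod_const, hfilter, Fin.card_Ioo,
    Finset.card_erase_of_mem (by simpa using e.2.ne'), Finset.card_erase_of_mem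
    (Finset.mem_univ _), Finset.card_univ, Fintype.card_fin,
    show 2 * k + 3 - 1 - 1 = 2 * k + 1 by omega, pow_succ, pow_mul, sq, hq.sq_eq_one, one_pow,
    one_mul] at hpos
  exact hpos

/-- Up to positive scalars and a global sign, the coefficient form of a relevant edge is the form
of its big half-plane. -/
theorem OrientedConvex.exists_edgeForm_eq (hq : OrientedConvex σ q) (i : ℕ) :
    ∃ κ : ℝ, 0 < κ ∧ ∀ p, ((-1 : ℝ) ^ k • edgeForm q (relEdge k i)) p = κ * bigForm σ q i p := by
  have hs := hq.prod_orient_sign (relEdge k i)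
  have hσ := hq.sq_eq_one
  have hk : ((-1 : ℝ) ^ k) * (-1) ^ k = 1 := by rw [← mul_pow]; norm_num
  set D := ∏ l ∈ (Finset.univ.erase (relEdge k i).fst).erase (relEdge k i).snd,
    orient (q (relEdge k i).fst) (q (relEdge k i).snd) (q l) with hD
  have hform : ∀ p, ((-1 : ℝ) ^ k • edgeForm q (relEdge k i)) p =
      (-1 : ℝ) ^ k * (D⁻¹ * lineForm (q (relEdge k i).fst) (q (relEdge k i).snd) p) := by
    intro p
    rw [LinearMap.smul_apply, edgeForm, LinearMap.smul_apply, smul_eq_mul, smul_eq_mul]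
  -- In the reversed case the product has one more sign `-1`, and `lineForm` also changes sign; the
  -- two cancel, so the global sign `(-1)^k` fits all relevant edges.
  rcases cyc_relEdge q i with ⟨h1, h2, h3⟩ | ⟨h1, h2, h3⟩
  · rw [show ((relEdge k i).snd : ℕ) - (relEdge k i).fst - 1 = k by omega] at hs
    refine ⟨_, inv_pos.2 hs, fun p => ?_⟩
    rw [hform, bigForm_apply, h2, h3, mul_inv, inv_eq_of_mul_eq_one_right
      (show σ * (-1) ^ k * (σ * (-1) ^ k) = 1 by
        linear_combination (-1 : ℝ) ^ k * (-1) ^ k * hσ + hk)]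
    linear_combination (-(-1 : ℝ) ^ k * D⁻¹ *
      lineForm (q (relEdge k i).fst) (q (relEdge k i).snd) p) * hσ
  · rw [show ((relEdge k i).snd : ℕ) - (relEdge k i).fst - 1 = k + 1 by omega] at hs
    refine ⟨_, inv_pos.2 hs, fun p => ?_⟩
    rw [hform, bigForm_apply, h2, h3, lineForm_swap (q (relEdge k i).fst), mul_inv,
      inv_eq_of_mul_eq_one_right
      (show σ * (-1) ^ (k + 1) * (σ * (-1) ^ (k + 1)) = 1 by
        rw [pow_succ]; linear_combination (-1 : ℝ) ^ k * (-1) ^ k * hσ + hk)]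
    rw [pow_succ]
    linear_combination (-(-1 : ℝ) ^ k * D⁻¹ *
      lineForm (q (relEdge k i).fst) (q (relEdge k i).snd) p) * hσ

/-- The sign of the form at `p` decides which vertices are counted: those outside the closed range
of the edge, those strictly inside it, or none. The first two counts are `k` and `k + 1` in some
order, so the cardinality singles out one sign. -/
theorem OrientedConvex.mem_bigHalfPlane_iff (hq : OrientedConvex σ q) (i : ℕ) (p : ℝ × ℝ) :
    p ∈ bigHalfPlane k q (relEdge k i) ↔ 0 < bigForm σ q i (p.1, p.2, 1) := by
  set e := relEdge k i with he
  set u := orient (q e.fst) (q e.snd) p with hu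
  have hσ := hq.sq_eq_one
  have hsign := hq.orient_edge_sign e
  have hself1 : orient (q e.fst) (q e.snd) (q e.fst) = 0 := by simp only [orient]; ring
  have hself2 : orient (q e.fst) (q e.snd) (q e.snd) = 0 := by simp only [orient]; ring
  have hmul : ∀ x : ℝ, u * x = (σ * u) * (σ * x) := fun x => by linear_combination (-u * x) * hσ
  have hfst := e.fst.2
  have hsnd := e.snd.2
  have hset : (0 < σ * u → {v : Fin (2 * k + 3) | 0 < u * orient (q e.fst) (q e.snd) (q v)} =
        ((Finset.Icc e.fst e.snd)ᶜ : Finset (Fin (2 * k + 3)))) ∧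
      (σ * u < 0 → {v : Fin (2 * k + 3) | 0 < u * orient (q e.fst) (q e.snd) (q v)} =
        (Finset.Ioo e.fst e.snd : Finset (Fin (2 * k + 3)))) := by
    have htri : ∀ v, v ∈ Finset.Ioo e.fst e.snd ∨ v ∉ Finset.Icc e.fst e.snd ∨
        (v ∉ Finset.Ioo e.fst e.snd ∧ v ∈ Finset.Icc e.fst e.snd ∧
          orient (q e.fst) (q e.snd) (q v) = 0) := by
      intro v
      by_cases h1 : v = e.fst
      · rw [h1]; exact Or.inr (Or.inr ⟨by simp, by simp [e.2.le], hself1⟩)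
      by_cases h2 : v = e.snd
      · rw [h2]; exact Or.inr (Or.inr ⟨by simp, by simp [e.2.le], hself2⟩)
      by_cases h3 : v ∈ Finset.Icc e.fst e.snd
      · rw [Finset.mem_Icc] at h3
        exact Or.inl (Finset.mem_Ioo.2 ⟨lt_of_le_of_ne h3.1 (Ne.symm h1), lt_of_le_of_ne h3.2 h2⟩)
      · exact Or.inr (Or.inl h3)
    have hsub : ∀ v, v ∈ Finset.Ioo e.fst e.snd → v ∈ Finset.Icc e.fst e.snd :=
      fun v h => Finset.Ioo_subset_Icc_self h
    constructor <;> intro hpos <;> ext v <;>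
      simp only [Set.mem_ofPred_eq, Finset.coe_compl, Set.mem_compl_iff, Finset.mem_coe] <;>
      rw [hmul]
    · rcases htri v with h | h | ⟨-, h, h0⟩
      · have := mul_neg_of_pos_of_neg hpos ((hsign v).1 h)
        exact iff_of_false this.not_gt (not_not.2 (hsub v h))
      · exact iff_of_true (mul_pos hpos ((hsign v).2 h)) h
      · rw [h0, mul_zero, mul_zero]
        exact iff_of_false (lt_irrefl _) (not_not.2 h)
    · rcases htri v with h | h | ⟨h, -, h0⟩
      · exact iff_of_true (mul_pos_of_neg_of_neg hpos ((hsign v).1 h)) h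
      · have := mul_neg_of_neg_of_pos hpos ((hsign v).2 h)
        exact iff_of_false this.not_gt fun h' => h (hsub v h')
      · rw [h0, mul_zero, mul_zero]
        exact iff_of_false (lt_irrefl _) h
  have hzero : σ * u = 0 →
      {v : Fin (2 * k + 3) | 0 < u * orient (q e.fst) (q e.snd) (q v)} = ∅ := by
    intro h0
    ext v
    simp only [Set.mem_ofPred_eq, Set.mem_empty_iff_false, iff_false]
    rw [hmul, h0, zero_mul]
    exact lt_irrefl _
  have c1 : ((Finset.Icc e.fst e.snd)ᶜ : Finset (Fin (2 * k + 3))).card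
      = 2 * k + 3 - ((e.snd : ℕ) + 1 - e.fst) := by
    rw [Finset.card_compl, Fintype.card_fin, Fin.card_Icc]
  have c2 : (Finset.Ioo e.fst e.snd).card = (e.snd : ℕ) - e.fst - 1 := Fin.card_Ioo ..
  change Set.ncard {v : Fin (2 * k + 3) | 0 < u * orient (q e.fst) (q e.snd) (q v)} = k + 1 ↔ _
  rw [bigForm_apply]
  have hlt : (e.fst : ℕ) < e.snd := e.2
  rcases cyc_relEdge q i with ⟨h1, h2, h3⟩ | ⟨h1, h2, h3⟩
  · rw [h2, h3, lineForm_point, ← he, ← hu]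
    rw [← he] at h1
    rcases lt_trichotomy (σ * u) 0 with h | h | h
    · rw [hset.2 h, Set.ncard_coe_finset, c2]
      exact iff_of_false (by omega) h.not_gt
    · rw [hzero h, Set.ncard_empty]
      exact iff_of_false (by omega) h.not_gt
    · rw [hset.1 h, Set.ncard_coe_finset, c1]
      exact iff_of_true (by omega) h
  · rw [h2, h3, lineForm_point, ← he, orient_swap, ← hu]
    rw [← he] at h1
    rcases lt_trichotomy (σ * u) 0 with h | h | h
    · rw [hset.2 h, Set.ncard_coe_finset, c2]
      exact iff_of_true (by omega) (by linarith)
    · rw [hzero h, Set.ncard_empty]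
      exact iff_of_false (by omega) (by linarith)
    · rw [hset.1 h, Set.ncard_coe_finset, c1]
      exact iff_of_false (by omega) (by linarith)

end Geometry

end Multiassociahedron
namespace Multiassociahedron

/-! ### The three equivalent conditions -/

section Main

variable {k : ℕ} {σ : ℝ} {q : Fin (2 * k + 3) → ℝ × ℝ}

theorem OrientedConvex.sum_row_eq_zero_iff (hk : 1 ≤ k) (hq : OrientedConvex σ q)
    (c : Edge (2 * k + 3) → ℝ) : ∑ e, c e • (cofactorMatrix (2 * k) q).row e = 0 ↔
      ∃ p, ∀ e, c e = ((-1 : ℝ) ^ k • edgeForm q e) p := by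
  have hk2 : ((-1 : ℝ) ^ k) * (-1) ^ k = 1 := by rw [← mul_pow]; norm_num
  rw [sum_row_eq_zero_iff_exists (even_two_mul k) (by omega) rfl q hq.orient_ne_zero]
  constructor
  · rintro ⟨p, hp⟩
    refine ⟨(-1 : ℝ) ^ k • p, fun e => ?_⟩
    rw [LinearMap.smul_apply, map_smul, smul_smul, hk2, one_smul, hp]
  · rintro ⟨p, hp⟩
    refine ⟨(-1 : ℝ) ^ k • p, fun e => ?_⟩
    rw [hp, LinearMap.smul_apply, map_smul]

/-- Some point lies in all big half-planes. -/
def HasCommonPoint (σ : ℝ) (q : Fin (2 * k + 3) → ℝ × ℝ) : Prop :=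
  ∃ x : ℝ × ℝ, ∀ i, 0 < bigForm σ q i (x.1, x.2, 1)

theorem OrientedConvex.hasCommonPoint_iff (hq : OrientedConvex σ q) :
    (⋂ e ∈ {e : Edge (2 * k + 3) | Relevant k e}, bigHalfPlane k q e).Nonempty ↔
      HasCommonPoint σ q := by
  constructor
  · rintro ⟨x, hx⟩
    refine ⟨x, fun i => (hq.mem_bigHalfPlane_iff i x).1 ?_⟩
    exact Set.mem_iInter₂.1 hx _ (relevant_relEdge k i)
  · rintro ⟨x, hx⟩
    refine ⟨x, Set.mem_iInter₂.2 fun e he => ?_⟩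
    obtain ⟨i, -, rfl⟩ := exists_relEdge_eq he
    exact (hq.mem_bigHalfPlane_iff i x).2 (hx i)

/-- Completeness puts `-∑ v e` into the cone of a face, which yields a dependency with all
coefficients at least `1`. It comes from a `p` on which all big forms are positive, and dividing by
its height gives the point. -/
theorem OrientedConvex.hasCommonPoint_of_realizes (hk : 1 ≤ k) (hq : OrientedConvex σ q)
    (h : RealizesAssociahedron k (cofactorMatrix (2 * k) q).row) : HasCommonPoint σ q := by
  classical
  obtain ⟨-, -, -, hcomplete⟩ := h
  set v := contraction (cofactorMatrix (2 * k) q).row {e | ¬ Relevant k e}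
  have hmem : -∑ e, v e ∈ (Submodule.span ℝ (Set.range v) : Set _) :=
    Submodule.neg_mem _ (Submodule.sum_mem _ fun e _ => Submodule.subset_span ⟨e, rfl⟩)
  rw [← hcomplete] at hmem
  obtain ⟨F, -, c, hc, hsum⟩ := Set.mem_iUnion₂.1 hmem
  have h0 : ∑ e, (1 + if e ∈ F then c e else 0) • v e = 0 := by
    simp only [add_smul, one_smul, Finset.sum_add_distrib]
    rw [sum_extend, ← hsum, add_neg_cancel]
  obtain ⟨p, hp⟩ := (sum_contraction_eq_zero_iff (hq.sum_row_eq_zero_iff hk) _).1 h0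
  have hpos : ∀ i, 0 < bigForm σ q i p := by
    intro i
    obtain ⟨κ, hκ, hκp⟩ := hq.exists_edgeForm_eq i
    have := hp (relEdge k i) (not_not.2 (relevant_relEdge k i))
    rw [hκp] at this
    refine pos_of_mul_pos_right (?_ : 0 < κ * _) hκ.le
    rw [← this]
    split_ifs with hF
    · have := hc _ hF
      linarith
    · norm_num
  have ht := hq.height_pos hk hpos
  refine ⟨(p.1 / p.2.2, p.2.1 / p.2.2), fun i => ?_⟩
  have hp' : ((p.1 / p.2.2, p.2.1 / p.2.2, 1) : ℝ × ℝ × ℝ) = p.2.2⁻¹ • p := by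
    ext
    · simp [div_eq_inv_mul]
    · simp [div_eq_inv_mul]
    · simp [ht.ne']
  rw [hp', map_smul]
  exact mul_pos (inv_pos.2 ht) (hpos i)

/-- If a set of relevant edges is not a face, then the small sides of the remaining relevant edges
have a vertex in common. -/
theorem OrientedConvex.exists_common_small (hq : OrientedConvex σ q)
    {F : Finset (Edge (2 * k + 3))} (hF : ¬ CrossingFree (k + 1) F) :
    ∃ j, ∀ i, relEdge k i ∉ F → bigForm σ q i (vtx q j) ≤ 0 := by
  unfold CrossingFree at hF
  push Not at hF
  obtain ⟨C, hCF, hC⟩ := hF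
  obtain ⟨j, hj⟩ := hC.exists_window
  -- The window `j, …, j + k` lies in `F`. Every other edge is `j + m` with `k < m ≤ 2k + 2`, and
  -- the vertex `j + 2k + 2` is at most `k + 1` steps after its start.
  refine ⟨j + (2 * k + 2), fun i hi => ?_⟩
  obtain ⟨m, hm, hmi⟩ := exists_modEq_add (n := 2 * k + 3) (by omega) i j
  have hkm : k < m := by
    by_contra! hle
    exact hi (by rw [← relEdge_congr hmi]; exact hCF (hj m hle))
  rw [← bigForm_congr hmi, show j + (2 * k + 2) = j + m + (2 * k + 2 - m) by omega]
  exact hq.bigForm_vtx_nonpos _ (by omega)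

theorem OrientedConvex.realizes_of_hasCommonPoint (hk : 1 ≤ k) (hq : OrientedConvex σ q)
    (h : HasCommonPoint σ q) : RealizesAssociahedron k (cofactorMatrix (2 * k) q).row := by
  classical
  obtain ⟨x, hx⟩ := h
  refine realizes_of_gale (ω := fun e => (-1 : ℝ) ^ k • edgeForm q e)
    (h := (LinearMap.snd ℝ ℝ ℝ).comp (LinearMap.snd ℝ ℝ (ℝ × ℝ))) (hq.sum_row_eq_zero_iff hk)
    ?_ (fun F hF e he => not_not.2 (hF.2 e he)) ?_ ⟨(x.1, x.2, 1), ?_⟩ ?_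
  · refine ⟨fun C hC hC' => ?_, fun e he => absurd he (Finset.notMem_empty e)⟩
    have := hC'.1
    rw [Finset.subset_empty.1 hC, Finset.card_empty] at this
    omega
  · intro F hF
    obtain ⟨a, s, r, hsr, ha, hs, hr⟩ := CrossingFree.exists_shortSteps hF.1
    obtain ⟨⟨la, lb, lc, h1, h2, h3, hcomb⟩, hinj⟩ := hq.height_eq_combination hx rfl a hsr
    obtain ⟨κa, ka, hka⟩ := hq.exists_edgeForm_eq a
    obtain ⟨κb, kb, hkb⟩ := hq.exists_edgeForm_eq (a + s)
    obtain ⟨κc, kc, hkc⟩ := hq.exists_edgeForm_eq (a + s + r)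
    refine ⟨relEdge k a, relEdge k (a + s), relEdge k (a + s + r),
      not_not.2 (relevant_relEdge _ _), not_not.2 (relevant_relEdge _ _),
      not_not.2 (relevant_relEdge _ _), ha, hs, hr, la / κa, lb / κb, lc / κc,
      div_pos h1 ka, div_pos h2 kb, div_pos h3 kc, fun p => ?_, fun p pa pb pc => ?_⟩
    · rw [hka, hkb, hkc, ← mul_assoc, ← mul_assoc, ← mul_assoc, div_mul_cancel₀ _ ka.ne',
        div_mul_cancel₀ _ kb.ne', div_mul_cancel₀ _ kc.ne']
      exact hcomb p
    · rw [hka] at pa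
      rw [hkb] at pb
      rw [hkc] at pc
      exact hinj p ((mul_eq_zero.1 pa).resolve_left ka.ne')
        ((mul_eq_zero.1 pb).resolve_left kb.ne') ((mul_eq_zero.1 pc).resolve_left kc.ne')
  · intro e he
    obtain ⟨i, -, rfl⟩ := exists_relEdge_eq (not_not.1 he)
    obtain ⟨κ, hκ, hκp⟩ := hq.exists_edgeForm_eq i
    rw [hκp]
    exact mul_pos hκ (hx i)
  · intro F hFI hF
    obtain ⟨j, hj⟩ := hq.exists_common_small (F := F) fun hfree =>
      hF ⟨hfree, fun e he => not_not.1 (hFI e he)⟩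
    -- The negated vertex has height `-1` and is nonnegative on all relevant edges outside `F`.
    refine ⟨-vtx q j, fun e he heF => ?_, ?_⟩
    · obtain ⟨i, -, rfl⟩ := exists_relEdge_eq (not_not.1 he)
      obtain ⟨κ, hκ, hκp⟩ := hq.exists_edgeForm_eq i
      rw [hκp, map_neg]
      exact mul_nonneg hκ.le (neg_nonneg.2 (hj i heF))
    · simp [vtx]

/-- A point on the nonnegative side of finitely many forms can be moved towards a second point that
is on the positive side of those forms that vanish at the first. -/
theorem exists_pos_of_perturb (I : Finset ℕ) {p p' : ℝ × ℝ × ℝ} (hp : p.2.2 = 1)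
    (hp' : p'.2.2 = 1)
    (h : ∀ i ∈ I, 0 < bigForm σ q i p ∨ (bigForm σ q i p = 0 ∧ 0 < bigForm σ q i p')) :
    ∃ x : ℝ × ℝ, ∀ i ∈ I, 0 < bigForm σ q i (x.1, x.2, 1) := by
  have hev : ∀ i ∈ I, ∀ᶠ s : ℝ in nhdsWithin 0 (Set.Ioi 0),
      0 < bigForm σ q i (p + s • (p' - p)) := by
    intro i hi
    rcases h i hi with h | ⟨h0, h1⟩
    · have hc : Filter.Tendsto (fun s : ℝ => bigForm σ q i p + s * bigForm σ q i (p' - p))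
          (nhdsWithin 0 (Set.Ioi 0))
          (nhds (bigForm σ q i p + 0 * bigForm σ q i (p' - p))) :=
        ((continuous_const.add (continuous_id.mul continuous_const)).tendsto 0).mono_left
          nhdsWithin_le_nhds
      rw [zero_mul, add_zero] at hc
      filter_upwards [hc.eventually (lt_mem_nhds h)] with s hs
      rw [map_add, map_smul, smul_eq_mul]
      exact hs
    · filter_upwards [self_mem_nhdsWithin] with s hs
      rw [map_add, map_smul, map_sub, h0, zero_add, sub_zero, smul_eq_mul]
      exact mul_pos hs h1
  obtain ⟨s, hs⟩ := ((Filter.eventually_all_finset I).2 hev).exists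
  refine ⟨((p + s • (p' - p)).1, (p + s • (p' - p)).2.1), fun i hi => ?_⟩
  have : (((p + s • (p' - p)).1, (p + s • (p' - p)).2.1, 1) : ℝ × ℝ × ℝ) = p + s • (p' - p) := by
    refine Prod.ext rfl (Prod.ext rfl ?_)
    simp [hp, hp']
  rw [this]
  exact hs i hi

/-- The big half-planes of `k + 2` consecutive relevant edges intersect. -/
theorem OrientedConvex.exists_common_of_window (hq : OrientedConvex σ q) (I : Finset ℕ) (j : ℕ)
    (hI : ∀ i ∈ I, ∃ m ≤ k + 1, (j + m) % (2 * k + 3) = i % (2 * k + 3)) :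
    ∃ x : ℝ × ℝ, ∀ i ∈ I, 0 < bigForm σ q i (x.1, x.2, 1) := by
  -- The vertex `j + 2k + 2` is strictly on the big side of the first `k + 1` edges and is an
  -- endpoint of the last one; the next vertex is strictly on the big side of that edge.
  refine exists_pos_of_perturb I (p := vtx q (j + (2 * k + 2)))
    (p' := vtx q (j + (k + 1) + (k + 2))) rfl rfl fun i hi => ?_
  obtain ⟨m, hm, hmi⟩ := hI i hi
  rw [← bigForm_congr hmi]
  rcases hm.eq_or_lt with rfl | hlt
  · right
    rw [show j + (2 * k + 2) = j + (k + 1) + (k + 1) by omega]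
    exact ⟨bigForm_vtx_succ _, hq.bigForm_vtx_pos _ le_rfl (by omega)⟩
  · left
    rw [show j + (2 * k + 2) = j + m + (2 * k + 2 - m) by omega]
    exact hq.bigForm_vtx_pos _ (by omega) (by omega)

/-- The big half-planes of two relevant edges with a common endpoint and of a third relevant edge
that has this endpoint on its big side intersect. -/
theorem OrientedConvex.exists_common_of_adjacent (hq : OrientedConvex σ q) (I : Finset ℕ)
    (a r : ℕ) (h1 : 1 ≤ r) (h2 : r ≤ k + 1)
    (hI : ∀ i ∈ I, i % (2 * k + 3) = a % (2 * k + 3) ∨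
      i % (2 * k + 3) = (a + (k + 1)) % (2 * k + 3) ∨
      i % (2 * k + 3) = (a + (k + 1) + r) % (2 * k + 3)) :
    ∃ x : ℝ × ℝ, ∀ i ∈ I, 0 < bigForm σ q i (x.1, x.2, 1) := by
  -- Start at the shared endpoint and move towards the midpoint of the other two endpoints, each of
  -- which is on the big side of the edge not containing it.
  refine exists_pos_of_perturb I (p := vtx q (a + (k + 1)))
    (p' := (2⁻¹ : ℝ) • (vtx q a + vtx q (a + (2 * k + 2)))) rfl
    (by simp [vtx]; norm_num) fun i hi => ?_
  rcases hI i hi with h | h | h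
  · right
    rw [bigForm_congr h]
    refine ⟨bigForm_vtx_succ _, ?_⟩
    rw [map_smul, map_add, bigForm_vtx_self, zero_add]
    exact mul_pos (by norm_num) (hq.bigForm_vtx_pos _ (by omega) le_rfl)
  · right
    rw [bigForm_congr h]
    refine ⟨bigForm_vtx_self _, ?_⟩
    rw [map_smul, map_add, show a + (2 * k + 2) = a + (k + 1) + (k + 1) by omega,
      bigForm_vtx_succ, add_zero, ← vtx_add_period a,
      show a + (2 * k + 3) = a + (k + 1) + (k + 2) by omega]
    exact mul_pos (by norm_num) (hq.bigForm_vtx_pos _ le_rfl (by omega))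
  · left
    rw [bigForm_congr h, ← vtx_add_period,
      show a + (k + 1) + (2 * k + 3) = a + (k + 1) + r + (2 * k + 3 - r) by omega]
    exact hq.bigForm_vtx_pos _ (by omega) (by omega)

theorem OrientedConvex.hasCommonPoint_of_octahedral (hq : OrientedConvex σ q)
    (h : ∀ T : Finset (Edge (2 * k + 3)), IsOctahedral k T →
      (⋂ e ∈ Tᶜ, bigHalfPlane k q e).Nonempty) : HasCommonPoint σ q := by
  classical
  have hhelly : (⋂ i ∈ Finset.range (2 * k + 3),
      {x : ℝ × ℝ | 0 < bigForm σ q i (x.1, x.2, 1)}).Nonempty := by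
    refine Convex.helly_theorem' (𝕜 := ℝ) ?_ ?_
    · intro i _ x hx y hy s t hs ht hst
      have hxy : (((s • x + t • y).1, (s • x + t • y).2, 1) : ℝ × ℝ × ℝ)
          = s • (x.1, x.2, 1) + t • (y.1, y.2, 1) := by
        refine Prod.ext rfl (Prod.ext rfl ?_)
        simp [hst]
      change 0 < bigForm σ q i _
      rw [hxy, map_add, map_smul, map_smul, smul_eq_mul, smul_eq_mul]
      have hx : 0 < bigForm σ q i (x.1, x.2, 1) := hx
      have hy : 0 < bigForm σ q i (y.1, y.2, 1) := hy
      rcases hs.eq_or_lt with rfl | hs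
      · rw [zero_add] at hst
        rw [hst, zero_mul, zero_add, one_mul]; exact hy
      · exact add_pos_of_pos_of_nonneg (mul_pos hs hx) (mul_nonneg ht hy.le)
    · intro I hIn hI
      have hI3 : I.card ≤ 3 := by simpa using hI
      suffices ∃ x : ℝ × ℝ, ∀ i ∈ I, 0 < bigForm σ q i (x.1, x.2, 1) by
        obtain ⟨x, hx⟩ := this
        exact ⟨x, Set.mem_iInter₂.2 hx⟩
      have hmod : ∀ i ∈ I, i % (2 * k + 3) = i := fun i hi =>
        Nat.mod_eq_of_lt (Finset.mem_range.1 (hIn hi))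
      -- Either the indices meet every window of length `k + 1`, hence form a triple with short
      -- steps, or they avoid one and lie in the complementary `k + 2` consecutive indices.
      by_cases hwin : ∀ j, ∃ m ≤ k, (j + m) % (2 * k + 3) ∈ I
      · obtain ⟨a, s, r, hsr, ha, hs, hr⟩ :=
          exists_shortSteps (P := fun i => i % (2 * k + 3) ∈ I) hwin
        have hne := hsr.relEdge_ne a
        have hIeq : ({a % (2 * k + 3), (a + s) % (2 * k + 3), (a + s + r) % (2 * k + 3)} :
            Finset ℕ) = I := by
          refine Finset.eq_of_subset_of_card_le ?_ ?_
          · intro i hi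
            simp only [Finset.mem_insert, Finset.mem_singleton] at hi
            rcases hi with rfl | rfl | rfl <;> assumption
          · rw [Finset.card_eq_three.2 ⟨_, _, _, fun h => hne.1 (relEdge_congr h),
              fun h => hne.2.1 (relEdge_congr h), fun h => hne.2.2 (relEdge_congr h), rfl⟩]
            exact hI3
        have hIcases : ∀ i ∈ I, i % (2 * k + 3) = a % (2 * k + 3) ∨
            i % (2 * k + 3) = (a + s) % (2 * k + 3) ∨
            i % (2 * k + 3) = (a + s + r) % (2 * k + 3) := by
          intro i hi
          rw [hmod i hi]
          rw [← hIeq] at hi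
          simpa using hi
        have hsr' := hsr
        obtain ⟨g1, g2, g3, g4, g5⟩ := hsr'
        -- A cyclic gap equal to `k + 1` means a shared vertex; the three gaps are `s`, `r` and `2k
        -- + 3 - s - r`. If none equals `k + 1`, the six endpoints are distinct and the octahedral
        -- hypothesis applies.
        by_cases c1 : s = k + 1
        · subst c1
          exact hq.exists_common_of_adjacent I a r g3 g4 hIcases
        by_cases c2 : r = k + 1
        · subst c2
          refine hq.exists_common_of_adjacent I (a + s) (k + 2 - s) (by omega) (by omega) ?_
          intro i hi
          have e1 : (a + s + (k + 1) + (k + 2 - s)) % (2 * k + 3) = a % (2 * k + 3) := by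
            rw [show a + s + (k + 1) + (k + 2 - s) = a + (2 * k + 3) by omega, Nat.add_mod_right]
          have := hIcases i hi
          rw [e1]; tauto
        by_cases c3 : s + r = k + 2
        · refine hq.exists_common_of_adjacent I (a + s + r) s (by omega) (by omega) ?_
          intro i hi
          have e1 : (a + s + r + (k + 1)) % (2 * k + 3) = a % (2 * k + 3) := by
            rw [show a + s + r + (k + 1) = a + (2 * k + 3) by omega, Nat.add_mod_right]
          have e2 : (a + s + r + (k + 1) + s) % (2 * k + 3) = (a + s) % (2 * k + 3) := by
            rw [show a + s + r + (k + 1) + s = a + s + (2 * k + 3) by omega, Nat.add_mod_right]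
          have := hIcases i hi
          rw [e1, e2]; tauto
        · obtain ⟨x, hx⟩ := h _ (hsr.isOctahedral a (by omega) (by omega) (by omega))
          rw [compl_compl] at hx
          refine ⟨x, fun i hi => (hq.mem_bigHalfPlane_iff i x).1 (Set.mem_iInter₂.1 hx _ ?_)⟩
          simp only [Finset.mem_insert, Finset.mem_singleton]
          rcases hIcases i hi with h | h | h
          · exact Or.inl (relEdge_congr h)
          · exact Or.inr (Or.inl (relEdge_congr h))
          · exact Or.inr (Or.inr (relEdge_congr h))
      · push Not at hwin
        obtain ⟨j, hj⟩ := hwin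
        refine hq.exists_common_of_window I (j + (k + 1)) fun i hi => ?_
        obtain ⟨m, hm, hmi⟩ := exists_modEq_add (n := 2 * k + 3) (by omega) i j
        have hkm : k < m := by
          by_contra! hle
          exact hj m hle (by rw [hmi, hmod i hi]; exact hi)
        exact ⟨m - (k + 1), by omega, by
          rw [show j + (k + 1) + (m - (k + 1)) = j + m by omega]; exact hmi⟩
  obtain ⟨x, hx⟩ := hhelly
  refine ⟨x, fun i => ?_⟩
  rw [bigForm_congr (Nat.mod_mod i (2 * k + 3)).symm]
  exact Set.mem_iInter₂.1 hx (i % (2 * k + 3))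
    (Finset.mem_range.2 (Nat.mod_lt _ (by omega)))

end Main

end Multiassociahedron

open Multiassociahedron in
theorem theorem3p11 (k : ℕ) (hk : 1 ≤ k) (q : Fin (2 * k + 3) → ℝ × ℝ) (hq : ConvexPosition q) :
    List.TFAE
      [RealizesAssociahedron k (cofactorMatrix (2 * k) q).row,
        ∀ T : Finset (Edge (2 * k + 3)), IsOctahedral k T →
          (⋂ e ∈ Tᶜ, bigHalfPlane k q e).Nonempty,
        (⋂ e ∈ {e : Edge (2 * k + 3) | Relevant k e}, bigHalfPlane k q e).Nonempty] := by
  obtain ⟨σ, hσ⟩ := hq.exists_oriented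
  tfae_have 1 → 3 := fun h => hσ.hasCommonPoint_iff.2 (hσ.hasCommonPoint_of_realizes hk h)
  tfae_have 3 → 1 := fun h => hσ.realizes_of_hasCommonPoint hk (hσ.hasCommonPoint_iff.1 h)
  tfae_have 2 → 3 := fun h => hσ.hasCommonPoint_iff.2 (hσ.hasCommonPoint_of_octahedral h)
  tfae_have 3 → 2 := fun ⟨x, hx⟩ T hT => ⟨x, Set.mem_iInter₂.2 fun e he =>
    Set.mem_iInter₂.1 hx e (hT.1.relevant_of_notMem (Finset.mem_compl.1 he))⟩
  tfae_finish
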